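/- Write $x=(x_h,x_3)\in\mathbb R^2\times\mathbb R$. For $s\in\mathbb R$ and a locally integrable function $f:\mathbb R^d\to\mathbb C$, let $$\|f\|_{\dot H^s(\mathbb R^d)}=\Bigl(\int_{\mathbb R^d}|\xi|^{2s}\,|\widehat f(\xi)|^2\,d\xi\Bigr)^{1/2}\in[0,\infty]$$ if $f$ is (as a distribution) a tempered distribution whose Fourier transform $\widehat f$ is a locally integrable function, and $\|f\|_{\dot H^s(\mathbb R^d)}=\infty$ otherwise. For $f:\mathbb R^3\to\mathbb C$ and $1\le p\le\infty$, let $\|f\|_{L^p_v\dot H^s_h}$ denote the $L^p(\mathbb R)$ norm of $x_3\mapsto\|f(\cdot,x_3)\|_{\dot H^s(\mathbb R^2)}$, and let $L^2_h=L^2(\mathbb R^2)$. There is an absolute constant $C<\infty$ such that for all $C^\infty$ functions $a,b:\mathbb R^3\to\mathbb C$, $$\|ab\|_{\dot H^{-1/2}(\mathbb R^3)}\le C\,\|a\|_{L^2_v\dot H^{1/2}_h}\,\|b(\cdot,0)\|_{L^2_h}+C\,\|x_3a\|_{L^2(\mathbb R^3)}\,\|\partial_3b\|_{L^\infty_v\dot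 H^{1/2}_h},$$ as an inequality in $[0,\infty]$ with the convention $0\cdot\infty=0$. In particular, if the right-hand side is finite, then $ab\in\dot H^{-1/2}(\mathbb R^3)$. -/

import Mathlib

open MeasureTheory FourierTransform
open scoped SchwartzMap ENNReal ContDiff

noncomputable section

/-- The plane `ℝ²` of horizontal variables `x_h = (x₁, x₂)`. -/
abbrev R2 : Type := EuclideanSpace ℝ (Fin 2)

/-- The space `ℝ³` of variables `x = (x_h, x₃)`. -/
abbrev R3 : Type := EuclideanSpace ℝ (Fin 3)

section Sobolev

variable {E : Type*} [NormedAddCommGroup E] [InnerProductSpace ℝ E] [FiniteDimensional ℝ E]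
  [MeasurableSpace E] [BorelSpace E]

/-- The tempered distribution `u` is (given by) the locally integrable function `f`: both agree
as distributions, that is, on all smooth compactly supported test functions. -/
def IsGivenBy (u : 𝓢'(E, ℂ)) (f : E → ℂ) : Prop :=
  LocallyIntegrable f volume ∧
    ∀ φ : 𝓢(E, ℂ), HasCompactSupport (φ : E → ℂ) → u φ = ∫ x, f x * φ x

/-- The norm `‖f‖_{Ḣ^s} = (∫ |ξ|^{2s} |f̂(ξ)|² dξ)^{1/2} ∈ [0, ∞]` of the homogeneous Sobolev space
`Ḣ^s(E)`, the space of the tempered distributions whose Fourier transform is a locally integrable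
function with `∫ |ξ|^{2s} |f̂(ξ)|² dξ < ∞`. There is at most one tempered distribution `u` given by
`f`, and (up to null sets) at most one locally integrable `g` that gives its Fourier transform `f̂`.
If there is none, the infimum is over the empty set and the norm is `∞`. -/
def homSobolevNorm (s : ℝ) (f : E → ℂ) : ℝ≥0∞ :=
  ⨅ (u : 𝓢'(E, ℂ)) (_ : IsGivenBy u f) (g : E → ℂ) (_ : IsGivenBy (𝓕 u) g),
    (∫⁻ ξ, ‖ξ‖ₑ ^ (2 * s) * ‖g ξ‖ₑ ^ (2 : ℝ)) ^ (1 / 2 : ℝ)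

end Sobolev

/-- The horizontal slice `f(·, x₃)` of a function `f` on `ℝ³`. -/
def hSlice (f : R3 → ℂ) (x₃ : ℝ) : R2 → ℂ := fun y => f !₂[y 0, y 1, x₃]

/-- The norm of `L^p_v Ḣ^s_h = L^p(ℝ; Ḣ^s(ℝ²))`: the `L^p` norm of `x₃ ↦ ‖f(·, x₃)‖_{Ḣ^s(ℝ²)}`. -/
def lpvHomSobolevNorm (p : ℝ≥0∞) (s : ℝ) (f : R3 → ℂ) : ℝ≥0∞ :=
  eLpNorm (fun x₃ : ℝ => homSobolevNorm s (hSlice f x₃)) p volume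

/-- The vertical derivative `∂₃ f`. -/
def vertDeriv (f : R3 → ℂ) : R3 → ℂ := fun x => fderiv ℝ f x (EuclideanSpace.single 2 1)

end

/-! On the slice at height `t`, write `a b(t) = a b(0) + a (b(t) - b(0))`. Horizontal Hölder with
exponents 4 and 2 puts both terms in `L^{4/3}_h`. In the first, `a` is measured in `L⁴_h` and `b(0)`
in `L²_h`. In the second, the increment is at most `|t|` times the supremum of `‖∂₃b‖` in `L⁴_h`,
and the factor `|t|` is absorbed by `a` in `L²_h`. The embedding of `Ḣ^{1/2}(ℝ²)` into `L⁴(ℝ²)`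
(`eLpNorm_four_le_homSobolevNorm`) turns both `L⁴_h` norms into the stated ones, so `ab` is
controlled in `L²_v L^{4/3}_h`.

It remains to embed `L²_v L^{4/3}_h` into `Ḣ^{-1/2}(ℝ³)` (`homSobolevNorm_neg_half_le`), by duality.
Hölder bounds the pairing of `F` with the Fourier transform of a Schwartz function `φ` by the norm
of `𝓕 φ` in `L²_v L⁴_h`. The planar embedding on slices, Plancherel in the vertical variable and
`|ξ_h| ≤ |ξ|` bound this by the `L²` norm of `|ξ|^{1/2} φ` (`lintegral_eLpNorm_hSlice_fourier_le`).
Riesz representation then yields `𝓕 F` as `|ξ|^{1/2}` times an `L²` function.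

The planar embedding comes from the layer-cake formula with a frequency cutoff that depends on the
level: the low frequencies are bounded pointwise, the high ones in `L²`
(`lintegral_enorm_pow_four_le_of_split`). -/

/-! ### The planar `L⁴` bound from a frequency splitting. -/

lemma lintegral_ball_inv_norm_plane {A : ℝ} (hA : 0 < A) :
    ∫⁻ ξ in Metric.ball (0 : R2) A, ‖ξ‖ₑ⁻¹ = ENNReal.ofReal (2 * Real.pi * A) := by
  have hd : Module.finrank ℝ R2 = 2 := by simp
  have hint : IntegrableOn (fun ξ : R2 => ‖ξ‖⁻¹) (Metric.ball 0 A) := by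
    refine integrableOn_ball_of_norm_le_rpow (C := 1) (α := 1) (by simp) (by simp) ?_ ?_
    · refine Filter.Eventually.of_forall fun x => ?_
      simp [Real.rpow_neg_one]
    · exact (measurable_norm.inv).aestronglyMeasurable
  have h1 : ∫ ξ in Metric.ball (0 : R2) A, ‖ξ‖⁻¹ = 2 * Real.pi * A := by
    have : ∀ ξ : R2, (Metric.ball (0 : R2) A).indicator (fun ξ => ‖ξ‖⁻¹) ξ
        = (fun r : ℝ => (Set.Iio A).indicator (fun r => r⁻¹) r) ‖ξ‖ := by
      intro ξ
      simp [Set.indicator]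
    rw [← integral_indicator Metric.isOpen_ball.measurableSet, funext this,
      integral_fun_norm_addHaar volume, hd]
    have h2 : ∫ y in Set.Ioi (0 : ℝ), y ^ (2 - 1) • (Set.Iio A).indicator (fun r => r⁻¹) y
        = ∫ y in Set.Ioi (0 : ℝ), (Set.Iio A).indicator (fun _ => (1 : ℝ)) y := by
      refine setIntegral_congr_fun measurableSet_Ioi fun y hy => ?_
      have hy' : y ≠ 0 := (ne_of_gt hy)
      by_cases h : y < A <;> simp [Set.indicator, h, hy']
    rw [h2, integral_indicator measurableSet_Iio, Measure.restrict_restrict measurableSet_Iio]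
    have h3 : Set.Iio A ∩ Set.Ioi (0 : ℝ) = Set.Ioo 0 A := by ext; simp [and_comm]
    rw [h3]
    simp [Measure.real, EuclideanSpace.volume_ball_fin_two, hA.le, Real.pi_pos.le]
    ring
  rw [← h1, ofReal_integral_eq_lintegral_ofReal hint
    (Filter.Eventually.of_forall fun x => by positivity)]
  refine lintegral_congr_ae ?_
  have h0 : ∀ᵐ ξ : R2 ∂(volume.restrict (Metric.ball 0 A)), ξ ≠ 0 :=
    ae_restrict_of_ae (by simp [ae_iff])
  filter_upwards [h0] with ξ hξ
  rw [ENNReal.ofReal_inv_of_pos (norm_pos_iff.2 hξ), ofReal_norm]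

/-- Cauchy–Schwarz on low frequencies. -/
lemma lintegral_ball_enorm_le_plane {g : R2 → ℂ} (hg : AEStronglyMeasurable g)
    {A m : ℝ} (hA : 0 < A) (hm : 0 ≤ m)
    (hgm : ∫⁻ ξ, ‖ξ‖ₑ * ‖g ξ‖ₑ ^ (2 : ℝ) ≤ ENNReal.ofReal m) :
    ∫⁻ ξ in Metric.ball (0 : R2) A, ‖g ξ‖ₑ ≤ ENNReal.ofReal (√ (2 * Real.pi * A * m)) := by
  have h0 : ∀ᵐ ξ : R2 ∂(volume.restrict (Metric.ball 0 A)), ξ ≠ 0 :=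
    ae_restrict_of_ae (by simp [ae_iff])
  have h1 : ∫⁻ ξ in Metric.ball (0 : R2) A, ‖g ξ‖ₑ
      = ∫⁻ ξ in Metric.ball (0 : R2) A,
        ((fun ξ : R2 => (‖ξ‖ₑ⁻¹) ^ (1 / 2 : ℝ)) * (fun ξ : R2 => (‖ξ‖ₑ) ^ (1 / 2 : ℝ) * ‖g ξ‖ₑ)) ξ := by
    refine lintegral_congr_ae ?_
    filter_upwards [h0] with ξ hξ
    have : ‖ξ‖ₑ ≠ 0 := by simpa using hξ
    rw [Pi.mul_apply, ← mul_assoc, ← ENNReal.mul_rpow_of_nonneg _ _ (by norm_num),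
      ENNReal.inv_mul_cancel this (by simp)]
    simp
  rw [h1]
  refine (ENNReal.lintegral_mul_le_Lp_mul_Lq _ Real.HolderConjugate.two_two ?_ ?_).trans ?_
  · fun_prop
  · exact (by fun_prop : AEMeasurable (fun ξ : R2 => ‖ξ‖ₑ ^ (1 / 2 : ℝ)) _).mul
      (hg.enorm.restrict)
  · have e1 : ∀ ξ : R2, ((‖ξ‖ₑ⁻¹) ^ (1 / 2 : ℝ)) ^ (2 : ℝ) = ‖ξ‖ₑ⁻¹ := fun ξ => by
      rw [← ENNReal.rpow_mul]; norm_num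
    have e2 : ∀ ξ : R2, ((‖ξ‖ₑ) ^ (1 / 2 : ℝ) * ‖g ξ‖ₑ) ^ (2 : ℝ)
        = ‖ξ‖ₑ * ‖g ξ‖ₑ ^ (2 : ℝ) := fun ξ => by
      rw [ENNReal.mul_rpow_of_nonneg _ _ (by norm_num), ← ENNReal.rpow_mul]; norm_num
    simp only [e1, e2]
    rw [lintegral_ball_inv_norm_plane hA, ← ENNReal.mul_rpow_of_nonneg _ _ (by norm_num),
      Real.sqrt_eq_rpow, ← ENNReal.ofReal_rpow_of_nonneg (by positivity) (by norm_num)]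
    refine ENNReal.rpow_le_rpow ?_ (by norm_num)
    rw [ENNReal.ofReal_mul (p := 2 * Real.pi * A) (by positivity)]
    exact mul_le_mul_right ((setLIntegral_le_lintegral _ _).trans hgm) _

/-- Bound for the superlevel sets. -/
lemma meas_superlevel_le_plane {f g : R2 → ℂ} (hg : AEStronglyMeasurable g)
    (h : ∀ A : ℝ, 0 < A → ∃ f₁ f₂ : R2 → ℂ, AEStronglyMeasurable f₂ ∧ f =ᵐ[volume] f₁ + f₂ ∧
      (∀ᵐ x, ‖f₁ x‖ₑ ≤ ∫⁻ ξ in Metric.ball (0 : R2) A, ‖g ξ‖ₑ) ∧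
      ∫⁻ x, ‖f₂ x‖ₑ ^ (2 : ℝ) ≤ ∫⁻ ξ in (Metric.ball (0 : R2) A)ᶜ, ‖g ξ‖ₑ ^ (2 : ℝ))
    {m t : ℝ} (hm : 0 < m) (ht : 0 < t)
    (hgm : ∫⁻ ξ, ‖ξ‖ₑ * ‖g ξ‖ₑ ^ (2 : ℝ) ≤ ENNReal.ofReal m) :
    volume {x | t < ‖f x‖} ≤ ENNReal.ofReal (4 / t ^ 2) *
      ∫⁻ ξ in (Metric.ball (0 : R2) (t ^ 2 / (8 * Real.pi * m)))ᶜ, ‖g ξ‖ₑ ^ (2 : ℝ) := by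
  have hpi := Real.pi_pos
  -- This radius makes the low-frequency bound `√(2πAm)` equal to `t / 2`. Where `‖f‖ > t`, the
  -- high-frequency part is then at least `t / 2`, and Chebyshev in `L²` applies.
  have hA : 0 < t ^ 2 / (8 * Real.pi * m) := by positivity
  obtain ⟨f₁, f₂, hf₂, hf, h₁, h₂⟩ := h _ hA
  have hlow := lintegral_ball_enorm_le_plane hg hA hm.le hgm
  have hs : √ (2 * Real.pi * (t ^ 2 / (8 * Real.pi * m)) * m) = t / 2 := by
    rw [show 2 * Real.pi * (t ^ 2 / (8 * Real.pi * m)) * m = (t / 2) ^ 2 by field_simp; norm_num]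
    exact Real.sqrt_sq (by positivity)
  rw [hs] at hlow
  have hsub : volume {x | t < ‖f x‖}
      ≤ volume {x | ENNReal.ofReal (t ^ 2 / 4) ≤ ‖f₂ x‖ₑ ^ (2 : ℝ)} := by
    refine measure_mono_ae ?_
    filter_upwards [hf, h₁] with x hx hx1 hxt
    have hxt : t < ‖f x‖ := hxt
    change ENNReal.ofReal (t ^ 2 / 4) ≤ ‖f₂ x‖ₑ ^ (2 : ℝ)
    have h3 : ‖f₁ x‖ ≤ t / 2 := by
      have := hx1.trans hlow
      rwa [← ofReal_norm, ENNReal.ofReal_le_ofReal_iff (by positivity)] at this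
    have h4 : t / 2 ≤ ‖f₂ x‖ := by
      have := norm_add_le (f₁ x) (f₂ x)
      rw [hx] at hxt
      simp only [Pi.add_apply] at hxt
      linarith
    rw [← ofReal_norm, ENNReal.ofReal_rpow_of_nonneg (norm_nonneg _) (by norm_num)]
    refine ENNReal.ofReal_le_ofReal ?_
    rw [Real.rpow_two]
    nlinarith
  refine hsub.trans ((meas_ge_le_lintegral_div (by exact hf₂.enorm.pow_const _)
    (by simpa using by positivity) ENNReal.ofReal_ne_top).trans ?_)
  rw [ENNReal.div_eq_inv_mul, ← ENNReal.ofReal_inv_of_pos (by positivity), inv_div]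
  gcongr

/-- Frequency splitting and the layer-cake formula give the `L⁴` bound in the plane. -/
lemma lintegral_enorm_pow_four_le_of_split {f g : R2 → ℂ} (hfm : AEStronglyMeasurable f)
    (hg : AEStronglyMeasurable g)
    (h : ∀ A : ℝ, 0 < A → ∃ f₁ f₂ : R2 → ℂ, AEStronglyMeasurable f₂ ∧ f =ᵐ[volume] f₁ + f₂ ∧
      (∀ᵐ x, ‖f₁ x‖ₑ ≤ ∫⁻ ξ in Metric.ball (0 : R2) A, ‖g ξ‖ₑ) ∧
      ∫⁻ x, ‖f₂ x‖ₑ ^ (2 : ℝ) ≤ ∫⁻ ξ in (Metric.ball (0 : R2) A)ᶜ, ‖g ξ‖ₑ ^ (2 : ℝ))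
    {m : ℝ} (hm : 0 < m)
    (hgm : ∫⁻ ξ, ‖ξ‖ₑ * ‖g ξ‖ₑ ^ (2 : ℝ) ≤ ENNReal.ofReal m) :
    ∫⁻ x, ‖f x‖ₑ ^ (4 : ℝ) ≤ ENNReal.ofReal (128 * Real.pi * m ^ 2) := by
  have hpi := Real.pi_pos
  have e1 : ∫⁻ x, ‖f x‖ₑ ^ (4 : ℝ) = ∫⁻ x, ENNReal.ofReal (‖f x‖ ^ (4 : ℝ)) := by
    refine lintegral_congr fun x => ?_
    rw [← ofReal_norm, ENNReal.ofReal_rpow_of_nonneg (norm_nonneg _) (by norm_num)]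
  rw [e1, lintegral_rpow_eq_lintegral_meas_lt_mul volume
    (Filter.Eventually.of_forall fun x => norm_nonneg _) hfm.norm.aemeasurable (by norm_num)]
  set S : Set (ℝ × R2) := {p | p.1 ^ 2 / (8 * Real.pi * m) ≤ ‖p.2‖} with hS
  have hSm : MeasurableSet S := by
    apply measurableSet_le <;> fun_prop
  have hmeas : AEMeasurable (fun p : ℝ × R2 => ENNReal.ofReal (4 * p.1) *
      S.indicator (fun p => ‖g p.2‖ₑ ^ (2 : ℝ)) p)
      ((volume.restrict (Set.Ioi (0 : ℝ))).prod volume) := by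
    refine AEMeasurable.mul (by fun_prop) (AEMeasurable.indicator ?_ hSm)
    exact (hg.comp_snd.enorm).pow_const _
  calc ENNReal.ofReal 4 * ∫⁻ t in Set.Ioi (0 : ℝ),
        volume {x | t < ‖f x‖} * ENNReal.ofReal (t ^ ((4 : ℝ) - 1))
      ≤ ENNReal.ofReal 4 * ∫⁻ t in Set.Ioi (0 : ℝ), ∫⁻ ξ, ENNReal.ofReal (4 * t) *
          S.indicator (fun p => ‖g p.2‖ₑ ^ (2 : ℝ)) (t, ξ) := by
        gcongr 1
        refine setLIntegral_mono' measurableSet_Ioi fun t ht => ?_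
        have ht : 0 < t := ht
        rw [lintegral_const_mul' _ _ ENNReal.ofReal_ne_top]
        have e2 : ∫⁻ ξ, S.indicator (fun p => ‖g p.2‖ₑ ^ (2 : ℝ)) (t, ξ)
            = ∫⁻ ξ in (Metric.ball (0 : R2) (t ^ 2 / (8 * Real.pi * m)))ᶜ, ‖g ξ‖ₑ ^ (2 : ℝ) := by
          rw [← lintegral_indicator Metric.isOpen_ball.measurableSet.compl]
          refine lintegral_congr fun ξ => ?_
          simp [Set.indicator, hS]
        rw [e2]
        refine (mul_le_mul_left (meas_superlevel_le_plane hg h hm ht hgm) _).trans ?_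
        rw [mul_right_comm, ← ENNReal.ofReal_mul (by positivity),
          show (4 : ℝ) - 1 = (3 : ℕ) by norm_num, Real.rpow_natCast,
          show 4 / t ^ 2 * t ^ 3 = 4 * t by field_simp]
    _ = ENNReal.ofReal 4 * ∫⁻ ξ, ∫⁻ t in Set.Ioi (0 : ℝ), ENNReal.ofReal (4 * t) *
          S.indicator (fun p => ‖g p.2‖ₑ ^ (2 : ℝ)) (t, ξ) := by
        rw [lintegral_lintegral_swap hmeas]
    _ ≤ ENNReal.ofReal 4 * ∫⁻ ξ, ENNReal.ofReal (32 * Real.pi * m) *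
          (‖ξ‖ₑ * ‖g ξ‖ₑ ^ (2 : ℝ)) := by
        gcongr with ξ
        -- For fixed `ξ`, membership in `S` forces `t ≤ r`. Bounding `4t` by `4r` on an interval of
        -- length `r` gives `4r² = 32πm‖ξ‖`, so the cutoff produces exactly the weight of the
        -- energy.
        set r : ℝ := √ (8 * Real.pi * m * ‖ξ‖) with hr
        calc ∫⁻ t in Set.Ioi (0 : ℝ), ENNReal.ofReal (4 * t) *
              S.indicator (fun p => ‖g p.2‖ₑ ^ (2 : ℝ)) (t, ξ)
            ≤ ∫⁻ t in Set.Ioi (0 : ℝ), (Set.Iic r).indicator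
                (fun _ => ENNReal.ofReal (4 * r) * ‖g ξ‖ₑ ^ (2 : ℝ)) t := by
              refine setLIntegral_mono' measurableSet_Ioi fun t ht => ?_
              have ht : 0 < t := ht
              by_cases hts : (t, ξ) ∈ S
              · have htr : t ≤ r := by
                  refine Real.le_sqrt_of_sq_le ?_
                  have := (div_le_iff₀ (by positivity)).1 (show t ^ 2 / (8 * Real.pi * m) ≤ ‖ξ‖ from hts)
                  linarith
                rw [Set.indicator_of_mem hts, Set.indicator_of_mem (by exact htr)]
                gcongr
              · simp [Set.indicator_of_notMem hts]
          _ = ENNReal.ofReal (4 * r) * ‖g ξ‖ₑ ^ (2 : ℝ) * ENNReal.ofReal r := by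
              rw [lintegral_indicator measurableSet_Iic,
                Measure.restrict_restrict measurableSet_Iic, Set.inter_comm, Set.Ioi_inter_Iic]
              simp
          _ = ENNReal.ofReal (32 * Real.pi * m) * (‖ξ‖ₑ * ‖g ξ‖ₑ ^ (2 : ℝ)) := by
              rw [mul_right_comm, ← ENNReal.ofReal_mul (by positivity), ← ofReal_norm ξ,
                ← mul_assoc, ← ENNReal.ofReal_mul (by positivity), mul_assoc 4 r r, hr,
                Real.mul_self_sqrt (by positivity)]
              congr 2
              ring
    _ = ENNReal.ofReal 4 * (ENNReal.ofReal (32 * Real.pi * m) *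
          ∫⁻ ξ, ‖ξ‖ₑ * ‖g ξ‖ₑ ^ (2 : ℝ)) := by
        rw [lintegral_const_mul' _ _ ENNReal.ofReal_ne_top]
    _ ≤ ENNReal.ofReal 4 * (ENNReal.ofReal (32 * Real.pi * m) * ENNReal.ofReal m) := by
        gcongr
    _ = ENNReal.ofReal (128 * Real.pi * m ^ 2) := by
        rw [← ENNReal.ofReal_mul (by positivity), ← ENNReal.ofReal_mul (by positivity)]
        congr 1
        ring

/-- The constant of the embedding of `Ḣ^{1/2}(ℝ²)` into `L⁴(ℝ²)`. -/
noncomputable def planeSobolevConst : ℝ≥0∞ := ENNReal.ofReal (128 * Real.pi) ^ (1 / 4 : ℝ)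

lemma planeSobolevConst_ne_zero : planeSobolevConst ≠ 0 := by
  have := Real.pi_pos
  simp [planeSobolevConst, this]

lemma planeSobolevConst_ne_top : planeSobolevConst ≠ ⊤ := by
  simp [planeSobolevConst, ENNReal.rpow_eq_top_iff, ENNReal.mul_eq_top]

/-- The splitting is kept as a hypothesis because it is obtained in two ways: for a function whose
Fourier transform is known only as a distribution, and for the Fourier transform of an integrable
function. -/
lemma eLpNorm_four_le_of_split {f g : R2 → ℂ} (hfm : AEStronglyMeasurable f)
    (hg : AEStronglyMeasurable g)
    (h : ∀ A : ℝ, 0 < A → ∃ f₁ f₂ : R2 → ℂ, AEStronglyMeasurable f₂ ∧ f =ᵐ[volume] f₁ + f₂ ∧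
      (∀ᵐ x, ‖f₁ x‖ₑ ≤ ∫⁻ ξ in Metric.ball (0 : R2) A, ‖g ξ‖ₑ) ∧
      ∫⁻ x, ‖f₂ x‖ₑ ^ (2 : ℝ) ≤ ∫⁻ ξ in (Metric.ball (0 : R2) A)ᶜ, ‖g ξ‖ₑ ^ (2 : ℝ))
    (hfin : ∫⁻ ξ, ‖ξ‖ₑ * ‖g ξ‖ₑ ^ (2 : ℝ) ≠ ⊤) :
    eLpNorm f 4 ≤ planeSobolevConst * (∫⁻ ξ, ‖ξ‖ₑ * ‖g ξ‖ₑ ^ (2 : ℝ)) ^ (1 / 2 : ℝ) := by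
  set M := ∫⁻ ξ, ‖ξ‖ₑ * ‖g ξ‖ₑ ^ (2 : ℝ) with hM
  have key : ∫⁻ x, ‖f x‖ₑ ^ (4 : ℝ) ≤ ENNReal.ofReal (128 * Real.pi) * M ^ (2 : ℝ) := by
    have hM' : M = ENNReal.ofReal M.toReal := (ENNReal.ofReal_toReal hfin).symm
    -- The layer-cake bound needs `m > 0`, while the energy may vanish; it is applied for `m` above
    -- the energy, and `m` then decreases to it.
    have h1 : ∀ m : ℝ, M.toReal < m →
        ∫⁻ x, ‖f x‖ₑ ^ (4 : ℝ) ≤ ENNReal.ofReal (128 * Real.pi * m ^ 2) := fun m hm =>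
      lintegral_enorm_pow_four_le_of_split hfm hg h (ENNReal.toReal_nonneg.trans_lt hm)
        (by rw [← hM, hM']; exact ENNReal.ofReal_le_ofReal hm.le)
    have hc : Filter.Tendsto (fun m : ℝ => ENNReal.ofReal (128 * Real.pi * m ^ 2))
        (nhdsWithin M.toReal (Set.Ioi M.toReal))
        (nhds (ENNReal.ofReal (128 * Real.pi * M.toReal ^ 2))) :=
      ((ENNReal.continuous_ofReal.comp (by fun_prop)).tendsto _).mono_left nhdsWithin_le_nhds
    have := ge_of_tendsto hc (by filter_upwards [self_mem_nhdsWithin] with m hm using h1 m hm)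
    rwa [ENNReal.ofReal_mul (by positivity), ← Real.rpow_two,
      ← ENNReal.ofReal_rpow_of_nonneg ENNReal.toReal_nonneg (by norm_num), ← hM'] at this
  rw [eLpNorm_eq_lintegral_rpow_enorm_toReal (by norm_num) (by norm_num)]
  simp only [ENNReal.toReal_ofNat]
  refine (ENNReal.rpow_le_rpow key (by norm_num)).trans_eq ?_
  rw [ENNReal.mul_rpow_of_nonneg _ _ (by norm_num), ← ENNReal.rpow_mul, planeSobolevConst]
  norm_num

/-! ### Density of compactly supported functions in the Schwartz space. -/

section Density

variable {E : Type*} [NormedAddCommGroup E] [InnerProductSpace ℝ E] [FiniteDimensional ℝ E]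

/-- There is a smooth cutoff function in every finite-dimensional space. -/
lemma exists_smooth_cutoff (E : Type*) [NormedAddCommGroup E] [InnerProductSpace ℝ E]
    [FiniteDimensional ℝ E] : ∃ κ : E → ℝ, ContDiff ℝ ∞ κ ∧ HasCompactSupport κ ∧
      (∀ x, ‖x‖ < 1 → κ x = 1) ∧ (∀ x, 0 ≤ κ x) ∧ ∀ x, κ x ≤ 1 := by
  let b : ContDiffBump (0 : E) := ⟨1, 2, one_pos, one_lt_two⟩
  refine ⟨b, b.contDiff, b.hasCompactSupport, fun x hx => b.one_of_mem_closedBall ?_,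
    fun x => b.nonneg, fun x => b.le_one⟩
  simpa using hx.le

/-- Scaling by a factor at most one does not increase bounds on derivatives. -/
lemma norm_iteratedFDeriv_comp_smul_le {E : Type*} [NormedAddCommGroup E] [NormedSpace ℝ E] {η : E → ℝ} (hη : ContDiff ℝ ∞ η) {j : ℕ} {B : ℝ}
    (hB : ∀ x, ‖iteratedFDeriv ℝ j η x‖ ≤ B) {c : ℝ} (hc : 0 ≤ c) (hc1 : c ≤ 1) (x : E) :
    ‖iteratedFDeriv ℝ j (fun y => η (c • y)) x‖ ≤ B := by
  have h := ContinuousLinearMap.iteratedFDeriv_comp_right (c • ContinuousLinearMap.id ℝ E)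
    hη x (i := j) (by exact_mod_cast le_top)
  have h' : (η ∘ (c • ContinuousLinearMap.id ℝ E)) = fun y => η (c • y) := by
    ext; simp
  rw [h'] at h
  rw [h]
  refine (ContinuousMultilinearMap.norm_compContinuousLinearMap_le _ _).trans ?_
  have hn : ‖c • ContinuousLinearMap.id ℝ E‖ ≤ 1 := by
    rw [norm_smul, Real.norm_of_nonneg hc]
    exact mul_le_one₀ hc1 (norm_nonneg _) ContinuousLinearMap.norm_id_le
  refine (mul_le_of_le_one_right (norm_nonneg _) ?_).trans (hB _)
  exact Finset.prod_le_one (fun _ _ => norm_nonneg _) fun _ _ => hn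

/-- Compactly supported functions are dense in the Schwartz space; the approximating sequence is
dominated by the function. -/
lemma SchwartzMap.exists_tendsto_hasCompactSupport (χ : 𝓢(E, ℂ)) :
    ∃ s : ℕ → 𝓢(E, ℂ), (∀ n, HasCompactSupport (s n)) ∧
      Filter.Tendsto s Filter.atTop (nhds χ) ∧ ∀ n x, ‖s n x‖ ≤ ‖χ x‖ := by
  obtain ⟨κ, hκ, hκc, hκ1, hκ0, hκle⟩ := exists_smooth_cutoff E
  set c : ℕ → ℝ := fun n => 1 / ((n : ℝ) + 1) with hc
  have hcpos : ∀ n, 0 < c n := fun n => by simp only [hc]; positivity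
  have hc1 : ∀ n, c n ≤ 1 := fun n => by
    simp only [hc]
    rw [div_le_one (by positivity)]
    linarith [Nat.cast_nonneg (α := ℝ) n]
  have hcont : ∀ n, ContDiff ℝ ∞ (fun x : E => κ (c n • x)) := fun n => by fun_prop
  have hcs : ∀ n, HasCompactSupport (fun x : E => κ (c n • x)) := fun n =>
    hκc.comp_smul (hcpos n).ne'
  have hsc : ∀ n, HasCompactSupport (fun x : E => κ (c n • x) • χ x) := fun n => (hcs n).smul_right
  have hss : ∀ n, ContDiff ℝ ∞ (fun x : E => κ (c n • x) • χ x) := fun n =>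
    (hcont n).smul (χ.smooth ⊤)
  refine ⟨fun n => (hsc n).toSchwartzMap (hss n), fun n => hsc n, ?_, fun n x => ?_⟩
  · rw [(schwartz_withSeminorms ℝ E ℂ).tendsto_nhds]
    rintro ⟨k, m⟩ ε hε
    set η : E → ℝ := fun x => κ x - 1 with hη
    have hηs : ContDiff ℝ ∞ η := by fun_prop
    have hB : ∀ j, ∃ B, 0 ≤ B ∧ ∀ x, ‖iteratedFDeriv ℝ j η x‖ ≤ B := by
      intro j
      obtain ⟨B, hB⟩ := ((hκc.iteratedFDeriv j).norm).exists_bound_of_continuous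
        ((hκ.continuous_iteratedFDeriv (m := j) (by exact_mod_cast le_top)).norm)
      have e : η = κ + fun _ => (-1 : ℝ) := by ext; simp [hη, sub_eq_add_neg]
      refine ⟨|B| + 1, by positivity, fun x => ?_⟩
      rw [e, iteratedFDeriv_add_apply (hκ.of_le (by exact_mod_cast le_top)).contDiffAt
        contDiffAt_const]
      refine (norm_add_le _ _).trans (add_le_add ?_ ?_)
      · have := hB x
        rw [norm_norm] at this
        exact this.trans (le_abs_self B)
      · rcases Nat.eq_zero_or_pos j with rfl | hj
        · simp
        · rw [iteratedFDeriv_const_of_ne hj.ne']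
          simp
    choose B hB0 hB using hB
    set M : ℝ := ∑ i ∈ Finset.range (m + 1), (m.choose i : ℝ) * B i *
      SchwartzMap.seminorm ℝ (k + 1) (m - i) χ with hM
    have hM0 : 0 ≤ M := Finset.sum_nonneg fun i _ => by have := hB0 i; positivity
    -- The error `η (c n • x) χ x` vanishes where `c n * ‖x‖ < 1`. Elsewhere one extra power of
    -- `‖x‖`, affordable for a Schwartz function, buys the factor `c n`.
    have hbound : ∀ n, schwartzSeminormFamily ℝ E ℂ (k, m)
        ((hsc n).toSchwartzMap (hss n) - χ) ≤ c n * M := by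
      intro n
      refine SchwartzMap.seminorm_le_bound ℝ k m _ (mul_nonneg (hcpos n).le hM0) fun x => ?_
      have e : (((hsc n).toSchwartzMap (hss n) - χ : 𝓢(E, ℂ)) : E → ℂ)
          = fun y => η (c n • y) • χ y := by
        ext y
        change κ (c n • y) • χ y - χ y = _
        simp [hη, sub_mul]
      rw [e]
      by_cases hx : ‖c n • x‖ < 1
      · have h0 : (fun y => η (c n • y) • χ y) =ᶠ[nhds x] fun _ => 0 := by
          have ho : IsOpen {y : E | ‖c n • y‖ < 1} := isOpen_lt (by fun_prop) continuous_const
          filter_upwards [ho.mem_nhds hx] with y hy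
          simp [hη, hκ1 _ hy]
        rw [(h0.iteratedFDeriv ℝ m).eq_of_nhds]
        have : iteratedFDeriv ℝ m (fun _ : E => (0 : ℂ)) x = 0 := by
          rw [iteratedFDeriv_fun_zero]; rfl
        rw [this, norm_zero, mul_zero]
        exact mul_nonneg (hcpos n).le hM0
      · have hx1 : 1 ≤ c n * ‖x‖ := by
          rwa [norm_smul, Real.norm_of_nonneg (hcpos n).le, not_lt] at hx
        have h1 := norm_iteratedFDeriv_smul_le (𝕜 := ℝ) (f := fun y => η (c n • y)) (g := χ)
          (N := ∞) (by fun_prop) (χ.smooth ⊤) x (n := m) (by exact_mod_cast le_top)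
        calc ‖x‖ ^ k * ‖iteratedFDeriv ℝ m (fun y => η (c n • y) • χ y) x‖
            ≤ (c n * ‖x‖) * (‖x‖ ^ k *
                ∑ i ∈ Finset.range (m + 1), (m.choose i : ℝ) *
                  ‖iteratedFDeriv ℝ i (fun y => η (c n • y)) x‖ *
                  ‖iteratedFDeriv ℝ (m - i) χ x‖) :=
              (mul_le_mul_of_nonneg_left h1 (by positivity)).trans
                (le_mul_of_one_le_left (by positivity) hx1)
          _ = c n * ∑ i ∈ Finset.range (m + 1), (m.choose i : ℝ) *
                  ‖iteratedFDeriv ℝ i (fun y => η (c n • y)) x‖ *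
                  (‖x‖ ^ (k + 1) * ‖iteratedFDeriv ℝ (m - i) χ x‖) := by
              rw [Finset.mul_sum, Finset.mul_sum, Finset.mul_sum]
              refine Finset.sum_congr rfl fun i _ => ?_
              ring
          _ ≤ c n * M := by
              have := hcpos n
              rw [hM]
              gcongr with i hi
              · exact mul_nonneg (by positivity) (hB0 i)
              · exact norm_iteratedFDeriv_comp_smul_le hηs (hB i) (hcpos n).le (hc1 n) x
              · exact χ.le_seminorm ℝ (k + 1) (m - i) x
    have hlim : Filter.Tendsto (fun n => c n * M) Filter.atTop (nhds 0) := by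
      simpa [hc] using (tendsto_one_div_add_atTop_nhds_zero_nat (𝕜 := ℝ)).mul_const M
    filter_upwards [hlim.eventually_lt_const hε] with n hn
    exact (hbound n).trans_lt hn
  · change ‖κ (c n • x) • χ x‖ ≤ _
    rw [norm_smul, Real.norm_of_nonneg (hκ0 _)]
    exact mul_le_of_le_one_left (norm_nonneg _) (hκle _)

end Density

/-! ### Distributions given by functions, and their Fourier transforms. -/

section Fourier

variable {E : Type*} [NormedAddCommGroup E] [InnerProductSpace ℝ E] [FiniteDimensional ℝ E]
  [MeasurableSpace E] [BorelSpace E]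

/-- If `g` is integrable against all Schwartz functions, the integral formula for the distribution
given by `g` holds for all of them. -/
lemma IsGivenBy.apply_eq_integral {u : 𝓢'(E, ℂ)} {g : E → ℂ} (h : IsGivenBy u g)
    (hg : ∀ χ : 𝓢(E, ℂ), Integrable (fun x => g x * χ x)) (χ : 𝓢(E, ℂ)) :
    u χ = ∫ x, g x * χ x := by
  obtain ⟨s, hs, hlim, hle⟩ := χ.exists_tendsto_hasCompactSupport
  have h1 : Filter.Tendsto (fun n => u (s n)) Filter.atTop (nhds (u χ)) :=
    (u.continuous.tendsto χ).comp hlim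
  have h2 : Filter.Tendsto (fun n => ∫ x, g x * s n x) Filter.atTop (nhds (∫ x, g x * χ x)) := by
    refine tendsto_integral_of_dominated_convergence (fun x => ‖g x * χ x‖)
      (fun n => (hg (s n)).1) (hg χ).norm (fun n => ?_) ?_
    · filter_upwards with x
      rw [norm_mul, norm_mul]
      gcongr
      exact hle n x
    · filter_upwards with x
      refine Filter.Tendsto.const_mul _ ?_
      have := (SchwartzMap.toBoundedContinuousFunctionCLM ℝ E ℂ).continuous.tendsto χ
      exact ((BoundedContinuousFunction.tendsto_iff_tendstoUniformly.1
        (this.comp hlim)).tendsto_at x)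
  have h3 : (fun n => u (s n)) = fun n => ∫ x, g x * s n x := by
    ext n
    exact h.2 _ (hs n)
  rw [h3] at h1
  exact tendsto_nhds_unique h1 h2

/-- Locally integrable functions that agree as distributions agree almost everywhere. -/
lemma ae_eq_of_integral_mul_schwartz_eq {f g : E → ℂ} (hf : LocallyIntegrable f)
    (hg : LocallyIntegrable g)
    (h : ∀ φ : 𝓢(E, ℂ), HasCompactSupport φ → ∫ x, f x * φ x = ∫ x, g x * φ x) :
    f =ᵐ[volume] g := by
  refine ae_eq_of_integral_contDiff_smul_eq hf hg fun φ hφ hφc => ?_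
  have hc : HasCompactSupport (Complex.ofRealCLM ∘ φ) := hφc.comp_left rfl
  have hs : ContDiff ℝ ∞ (Complex.ofRealCLM ∘ φ) := by fun_prop
  have := h (hc.toSchwartzMap hs) hc
  simpa [mul_comm] using this

lemma integral_fourier_mul_schwartz {f : E → ℂ} (hf : Integrable f) (φ : 𝓢(E, ℂ)) :
    ∫ x, 𝓕 f x * φ x = ∫ x, f x * 𝓕 φ x := by
  simpa using! VectorFourier.integral_bilin_fourierIntegral_eq_flip (.mul ℂ ℂ) (L := innerₗ E)
    Real.continuous_fourierChar continuous_inner hf φ.integrable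

lemma integral_fourierInv_mul_schwartz {f : E → ℂ} (hf : Integrable f) (φ : 𝓢(E, ℂ)) :
    ∫ x, 𝓕⁻ f x * φ x = ∫ x, f x * 𝓕⁻ φ x := by
  have h1 : ∀ x, 𝓕⁻ f x = 𝓕 f (-x) := fun x => by rw [Real.fourierInv_eq_fourier_neg]
  have h2 : ∀ x, (𝓕⁻ φ : 𝓢(E, ℂ)) x = 𝓕 φ (-x) := fun x => by
    rw [SchwartzMap.fourierInv_coe, Real.fourierInv_eq_fourier_neg]; rfl
  have hn : Integrable (fun x => f (-x)) := hf.comp_neg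
  have h3 : ∀ x, 𝓕 f (-x) = 𝓕 (fun y => f (-y)) x := fun x => by
    have := Real.fourierInv_eq_fourier_comp_neg f
    rw [← this, Real.fourierInv_eq_fourier_neg]
  simp only [h1, h2, h3]
  rw [integral_fourier_mul_schwartz hn φ, ← integral_neg_eq_self]
  simp

lemma enorm_coe_circle (z : Circle) : ‖(z : ℂ)‖ₑ = 1 := by
  rw [← ofReal_norm, Circle.norm_coe, ENNReal.ofReal_one]

lemma enorm_fourier_le (f : E → ℂ) (x : E) : ‖𝓕 f x‖ₑ ≤ ∫⁻ y, ‖f y‖ₑ := by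
  rw [Real.fourier_eq]
  refine (enorm_integral_le_lintegral_enorm _).trans_eq ?_
  refine lintegral_congr fun y => ?_
  rw [Circle.smul_def, enorm_smul, enorm_coe_circle, one_mul]

lemma enorm_fourierInv_le (f : E → ℂ) (x : E) : ‖𝓕⁻ f x‖ₑ ≤ ∫⁻ y, ‖f y‖ₑ := by
  rw [Real.fourierInv_eq_fourier_neg]
  exact enorm_fourier_le f _

lemma continuous_fourier_of_integrable {f : E → ℂ} (hf : Integrable f) : Continuous (𝓕 f) :=
  VectorFourier.fourierIntegral_continuous Real.continuous_fourierChar continuous_inner hf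

lemma continuous_fourierInv_of_integrable {f : E → ℂ} (hf : Integrable f) : Continuous (𝓕⁻ f) := by
  have : 𝓕⁻ f = fun x => 𝓕 f (-x) := funext fun x => Real.fourierInv_eq_fourier_neg f x
  rw [this]
  exact (continuous_fourier_of_integrable hf).comp continuous_neg

lemma fourierLp_apply_schwartz {g : E → ℂ} (hg : MemLp g 2) (φ : 𝓢(E, ℂ)) :
    ∫ x, (𝓕 (hg.toLp g) : Lp ℂ 2 volume) x * φ x = ∫ x, g x * 𝓕 φ x := by
  have := congrArg (fun u : 𝓢'(E, ℂ) => u φ) (Lp.fourier_toTemperedDistribution_eq (hg.toLp g))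
  simp only [TemperedDistribution.fourier_apply, Lp.toTemperedDistribution_apply,
    smul_eq_mul] at this
  simp only [mul_comm _ (φ _)]
  rw [← this]
  refine integral_congr_ae ?_
  filter_upwards [hg.coeFn_toLp] with x hx
  rw [hx, mul_comm]

lemma fourierInvLp_apply_schwartz {g : E → ℂ} (hg : MemLp g 2) (φ : 𝓢(E, ℂ)) :
    ∫ x, (𝓕⁻ (hg.toLp g) : Lp ℂ 2 volume) x * φ x = ∫ x, g x * 𝓕⁻ φ x := by
  have := congrArg (fun u : 𝓢'(E, ℂ) => u φ)
    (Lp.fourierInv_toTemperedDistribution_eq (hg.toLp g))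
  simp only [TemperedDistribution.fourierInv_apply, Lp.toTemperedDistribution_apply,
    smul_eq_mul] at this
  simp only [mul_comm _ (φ _)]
  rw [← this]
  refine integral_congr_ae ?_
  filter_upwards [hg.coeFn_toLp] with x hx
  rw [hx, mul_comm]

lemma eLpNorm_fourierInvLp {g : E → ℂ} (hg : MemLp g 2) :
    eLpNorm (𝓕⁻ (hg.toLp g) : Lp ℂ 2 volume) 2 volume = eLpNorm g 2 volume := by
  rw [← Lp.enorm_def, ← ofReal_norm, ← Lp.norm_fourier_eq, FourierTransform.fourier_fourierInv_eq,
    ofReal_norm, Lp.enorm_def]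
  exact eLpNorm_congr_ae hg.coeFn_toLp

/-- Plancherel's theorem for integrable and square integrable functions. -/
lemma eLpNorm_two_fourier {g : E → ℂ} (hg : Integrable g) (hg2 : MemLp g 2) :
    eLpNorm (𝓕 g) 2 volume = eLpNorm g 2 volume := by
  have h : 𝓕 g =ᵐ[volume] (𝓕 (hg2.toLp g) : Lp ℂ 2 volume) := by
    refine ae_eq_of_integral_mul_schwartz_eq (continuous_fourier_of_integrable hg).locallyIntegrable
      ((Lp.memLp _).locallyIntegrable one_le_two) fun φ _ => ?_
    rw [integral_fourier_mul_schwartz hg, fourierLp_apply_schwartz]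
  rw [eLpNorm_congr_ae h, ← Lp.enorm_def, ← ofReal_norm, Lp.norm_fourier_eq, ofReal_norm,
    Lp.enorm_def]
  exact eLpNorm_congr_ae hg2.coeFn_toLp

end Fourier

/-! ### The embedding of `Ḣ^{1/2}(ℝ²)` into `L⁴(ℝ²)`. -/

/-- A function with finite weighted energy is square integrable away from the origin. -/
lemma memLp_two_indicator_ball_compl {g : R2 → ℂ} (hg : AEStronglyMeasurable g)
    (hfin : ∫⁻ ξ, ‖ξ‖ₑ * ‖g ξ‖ₑ ^ (2 : ℝ) ≠ ⊤) {A : ℝ} (hA : 0 < A) :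
    MemLp ((Metric.ball (0 : R2) A)ᶜ.indicator g) 2 := by
  refine ⟨hg.indicator Metric.isOpen_ball.measurableSet.compl, ?_⟩
  rw [eLpNorm_lt_top_iff_lintegral_rpow_enorm_lt_top (by norm_num) (by norm_num)]
  simp only [ENNReal.toReal_ofNat]
  calc ∫⁻ ξ, ‖(Metric.ball (0 : R2) A)ᶜ.indicator g ξ‖ₑ ^ (2 : ℝ)
      ≤ ∫⁻ ξ, ENNReal.ofReal A⁻¹ * (‖ξ‖ₑ * ‖g ξ‖ₑ ^ (2 : ℝ)) := by
        refine lintegral_mono fun ξ => ?_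
        by_cases hξ : ξ ∈ (Metric.ball (0 : R2) A)ᶜ
        · rw [Set.indicator_of_mem hξ, ← mul_assoc]
          refine le_mul_of_one_le_left zero_le ?_
          have hξ' : A ≤ ‖ξ‖ := by simpa using hξ
          rw [← ofReal_norm, ← ENNReal.ofReal_mul (by positivity), ENNReal.one_le_ofReal]
          rw [inv_mul_eq_div, one_le_div hA]
          exact hξ'
        · simp [Set.indicator_of_notMem hξ]
    _ < ⊤ := by
        rw [lintegral_const_mul' _ _ ENNReal.ofReal_ne_top]
        exact ENNReal.mul_lt_top ENNReal.ofReal_lt_top hfin.lt_top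

/-- The embedding of `Ḣ^{1/2}(ℝ²)` into `L⁴(ℝ²)`. -/
theorem eLpNorm_four_le_homSobolevNorm (f : R2 → ℂ) :
    eLpNorm f 4 volume ≤ planeSobolevConst * homSobolevNorm (1 / 2) f := by
  rw [mul_comm, ← ENNReal.div_le_iff planeSobolevConst_ne_zero planeSobolevConst_ne_top]
  refine le_iInf fun u => le_iInf fun hu => le_iInf fun g => le_iInf fun hg => ?_
  rw [ENNReal.div_le_iff planeSobolevConst_ne_zero planeSobolevConst_ne_top, mul_comm]
  have hpow : ∀ ξ : R2, ‖ξ‖ₑ ^ (2 * (1 / 2 : ℝ)) = ‖ξ‖ₑ := fun ξ => by norm_num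
  simp only [hpow]
  by_cases hfin : ∫⁻ ξ, ‖ξ‖ₑ * ‖g ξ‖ₑ ^ (2 : ℝ) = ⊤
  · rw [hfin, ENNReal.top_rpow_of_pos (by norm_num), ENNReal.mul_top planeSobolevConst_ne_zero]
    exact le_top
  have hgm := hg.1.aestronglyMeasurable
  refine eLpNorm_four_le_of_split hu.1.aestronglyMeasurable hgm (fun A hA => ?_) hfin
  set B := Metric.ball (0 : R2) A with hB
  have hBm : MeasurableSet B := Metric.isOpen_ball.measurableSet
  have h1 : Integrable (B.indicator g) := by
    rw [integrable_indicator_iff hBm]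
    exact (hg.1.integrableOn_isCompact (isCompact_closedBall 0 A)).mono_set
      Metric.ball_subset_closedBall
  have h2 : MemLp (Bᶜ.indicator g) 2 := memLp_two_indicator_ball_compl hgm hfin hA
  have hsum : ∀ ξ, g ξ = B.indicator g ξ + Bᶜ.indicator g ξ := fun ξ =>
    (congrFun (Set.indicator_self_add_compl B g) ξ).symm
  have hi1 : ∀ χ : 𝓢(R2, ℂ), Integrable (fun ξ => B.indicator g ξ * χ ξ) := fun χ =>
    h1.mul_bdd (c := SchwartzMap.seminorm ℝ 0 0 χ) χ.continuous.aestronglyMeasurable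
      (Filter.Eventually.of_forall fun x => χ.norm_le_seminorm ℝ x)
  have hi2 : ∀ χ : 𝓢(R2, ℂ), Integrable (fun ξ => Bᶜ.indicator g ξ * χ ξ) := fun χ =>
    h2.integrable_mul (χ.memLp 2)
  have hi : ∀ χ : 𝓢(R2, ℂ), Integrable (fun ξ => g ξ * χ ξ) := fun χ => by
    refine ((hi1 χ).add (hi2 χ)).congr (Filter.Eventually.of_forall fun ξ => ?_)
    simp only [Pi.add_apply]
    rw [← add_mul, ← hsum]
  have hloc1 : LocallyIntegrable (𝓕⁻ (B.indicator g)) :=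
    (continuous_fourierInv_of_integrable h1).locallyIntegrable
  have hloc2 : LocallyIntegrable (𝓕⁻ (h2.toLp _) : Lp ℂ 2 (volume : Measure R2)) :=
    (Lp.memLp _).locallyIntegrable one_le_two
  refine ⟨𝓕⁻ (B.indicator g), (𝓕⁻ (h2.toLp _) : Lp ℂ 2 (volume : Measure R2)),
    (Lp.memLp _).1, ?_, ?_, ?_⟩
  · refine ae_eq_of_integral_mul_schwartz_eq hu.1 (hloc1.add hloc2) fun φ hφ => ?_
    -- The function `𝓕⁻ φ` need not have compact support, so the definition of `IsGivenBy` does not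
    -- apply to it directly; the density argument in `IsGivenBy.apply_eq_integral` does.
    have e1 : ∫ x, f x * φ x = ∫ ξ, g ξ * 𝓕⁻ φ ξ := by
      rw [← hu.2 φ hφ, ← hg.apply_eq_integral hi, TemperedDistribution.fourier_apply,
        FourierTransform.fourier_fourierInv_eq]
    rw [e1]
    simp only [Pi.add_apply, add_mul]
    rw [integral_add, integral_fourierInv_mul_schwartz h1, fourierInvLp_apply_schwartz h2,
      ← integral_add (hi1 _) (hi2 _)]
    · refine integral_congr_ae (Filter.Eventually.of_forall fun ξ => ?_)
      simp only
      rw [← add_mul, ← hsum]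
    · exact φ.integrable.bdd_mul (continuous_fourierInv_of_integrable h1).aestronglyMeasurable
        (Filter.Eventually.of_forall fun x => by
          have := enorm_fourierInv_le (B.indicator g) x
          rw [← ofReal_norm, ← ofReal_integral_norm_eq_lintegral_enorm h1] at this
          exact (ENNReal.ofReal_le_ofReal_iff (by positivity)).1 this)
    · exact (Lp.memLp _).integrable_mul (φ.memLp 2)
  · refine Filter.Eventually.of_forall fun x => (enorm_fourierInv_le _ x).trans_eq ?_
    rw [← lintegral_indicator hBm]
    exact lintegral_congr fun ξ => enorm_indicator_eq_indicator_enorm _ _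
  · have h3 := eLpNorm_fourierInvLp h2
    rw [eLpNorm_eq_lintegral_rpow_enorm_toReal (by norm_num) (by norm_num),
      eLpNorm_eq_lintegral_rpow_enorm_toReal (by norm_num) (by norm_num)] at h3
    simp only [ENNReal.toReal_ofNat] at h3
    have h4 := (ENNReal.rpow_left_injective (x := 1 / 2) (by norm_num)) h3
    rw [h4, ← lintegral_indicator hBm.compl]
    refine lintegral_mono fun ξ => ?_
    by_cases hξ : ξ ∈ Bᶜ
    · simp [Set.indicator_of_mem hξ]
    · simp [Set.indicator_of_notMem hξ]

/-- Plancherel's theorem as an identity between lower Lebesgue integrals. -/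
lemma lintegral_enorm_fourier_rpow_two {E : Type*} [NormedAddCommGroup E] [InnerProductSpace ℝ E]
    [FiniteDimensional ℝ E] [MeasurableSpace E] [BorelSpace E] {g : E → ℂ} (hg : Integrable g)
    (hg2 : MemLp g 2) : ∫⁻ x, ‖𝓕 g x‖ₑ ^ (2 : ℝ) = ∫⁻ x, ‖g x‖ₑ ^ (2 : ℝ) := by
  have h := eLpNorm_two_fourier hg hg2
  rw [eLpNorm_eq_lintegral_rpow_enorm_toReal (by norm_num) (by norm_num),
    eLpNorm_eq_lintegral_rpow_enorm_toReal (by norm_num) (by norm_num)] at h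
  exact (ENNReal.rpow_left_injective (x := 1 / 2) (by norm_num)) h

/-- The `L⁴` bound for the Fourier transform of an integrable function on the plane. -/
lemma eLpNorm_four_fourier_le {g : R2 → ℂ} (hg : Integrable g) :
    eLpNorm (𝓕 g) 4 volume ≤
      planeSobolevConst * (∫⁻ ξ, ‖ξ‖ₑ * ‖g ξ‖ₑ ^ (2 : ℝ)) ^ (1 / 2 : ℝ) := by
  by_cases hfin : ∫⁻ ξ, ‖ξ‖ₑ * ‖g ξ‖ₑ ^ (2 : ℝ) = ⊤
  · rw [hfin, ENNReal.top_rpow_of_pos (by norm_num), ENNReal.mul_top planeSobolevConst_ne_zero]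
    exact le_top
  refine eLpNorm_four_le_of_split (continuous_fourier_of_integrable hg).aestronglyMeasurable hg.1
    (fun A hA => ?_) hfin
  have hBm : MeasurableSet (Metric.ball (0 : R2) A) := Metric.isOpen_ball.measurableSet
  have h1 := hg.indicator hBm
  have h2 := hg.indicator hBm.compl
  refine ⟨𝓕 ((Metric.ball (0 : R2) A).indicator g), _, (continuous_fourier_of_integrable h2).aestronglyMeasurable, ?_,
    Filter.Eventually.of_forall fun x => (enorm_fourier_le _ x).trans_eq ?_, ?_⟩
  · refine Filter.Eventually.of_forall fun x => ?_
    rw [Pi.add_apply, Real.fourier_eq, Real.fourier_eq, Real.fourier_eq, ← integral_add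
      ((Real.fourierIntegral_convergent_iff x).2 h1) ((Real.fourierIntegral_convergent_iff x).2 h2)]
    refine integral_congr_ae (Filter.Eventually.of_forall fun ξ => ?_)
    simp only
    rw [← smul_add, ← Pi.add_apply, Set.indicator_self_add_compl]
  · rw [← lintegral_indicator hBm]
    exact lintegral_congr fun ξ => enorm_indicator_eq_indicator_enorm _ _
  · rw [lintegral_enorm_fourier_rpow_two h2 (memLp_two_indicator_ball_compl hg.1 hfin hA),
      ← lintegral_indicator hBm.compl]
    refine lintegral_mono fun ξ => ?_
    by_cases hξ : ξ ∈ (Metric.ball (0 : R2) A)ᶜ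
    · simp [Set.indicator_of_mem hξ]
    · simp [Set.indicator_of_notMem hξ]

/-! ### Horizontal slices, vertical Fourier transform and mixed norms. -/

/-- The identification of `ℝ² × ℝ` with `ℝ³`. -/
noncomputable def prodToR3 : R2 × ℝ ≃ᵐ R3 :=
  ((((MeasurableEquiv.toLp 2 (Fin 2 → ℝ)).symm.prodCongr (MeasurableEquiv.refl ℝ)).trans
    MeasurableEquiv.prodComm).trans
    (MeasurableEquiv.piFinSuccAbove (fun _ : Fin 3 => ℝ) 2).symm).trans
    (MeasurableEquiv.toLp 2 (Fin 3 → ℝ))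

lemma prodToR3_apply (y : R2) (t : ℝ) : prodToR3 (y, t) = !₂[y 0, y 1, t] := by
  ext i
  fin_cases i <;> rfl

lemma hSlice_eq (f : R3 → ℂ) (t : ℝ) (y : R2) : hSlice f t y = f (prodToR3 (y, t)) := by
  rw [prodToR3_apply]; rfl

lemma measurePreserving_prodToR3 : MeasurePreserving prodToR3 (volume.prod volume) volume := by
  refine MeasurePreserving.trans (MeasurePreserving.trans (MeasurePreserving.trans
    (μb := (volume : Measure (Fin 2 → ℝ)).prod volume) ?_
    (μc := (volume : Measure ℝ).prod (volume : Measure (Fin 2 → ℝ))) ?_)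
    (μc := (volume : Measure (Fin 3 → ℝ))) ?_) ?_
  · exact (EuclideanSpace.volume_preserving_symm_measurableEquiv_toLp (Fin 2)).prod
      (MeasurePreserving.id _)
  · exact Measure.measurePreserving_swap
  · exact (volume_preserving_piFinSuccAbove (fun _ : Fin 3 => ℝ) 2).symm _
  · exact (EuclideanSpace.volume_preserving_symm_measurableEquiv_toLp (Fin 3)).symm _

lemma continuous_prodToR3 : Continuous prodToR3 := by
  have : (prodToR3 : R2 × ℝ → R3) = fun p => !₂[p.1 0, p.1 1, p.2] := by
    ext1 p
    exact prodToR3_apply p.1 p.2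
  rw [this]
  refine (PiLp.continuous_toLp 2 _).comp (continuous_pi fun i => ?_)
  fin_cases i <;> simp <;> fun_prop

lemma inner_prodToR3 (y x : R2) (s t : ℝ) :
    inner ℝ (prodToR3 (y, s)) (prodToR3 (x, t)) = inner ℝ y x + s * t := by
  rw [prodToR3_apply, prodToR3_apply]
  simp [PiLp.inner_apply, Fin.sum_univ_succ]
  ring

lemma norm_le_norm_prodToR3 (y : R2) (s : ℝ) : ‖y‖ ≤ ‖prodToR3 (y, s)‖ := by
  rw [← sq_le_sq₀ (norm_nonneg _) (norm_nonneg _), ← real_inner_self_eq_norm_sq,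
    ← real_inner_self_eq_norm_sq, inner_prodToR3]
  nlinarith [mul_self_nonneg s]

lemma lintegral_R3 (f : R3 → ℝ≥0∞) (hf : Measurable f) :
    ∫⁻ x, f x = ∫⁻ t : ℝ, ∫⁻ y : R2, f (prodToR3 (y, t)) := by
  rw [← measurePreserving_prodToR3.lintegral_comp hf,
    lintegral_prod_symm' (fun p => f (prodToR3 p)) (hf.comp prodToR3.measurable)]

/-- The horizontal slices of a Fourier transform are Fourier transforms of the partial Fourier
transform in the vertical variable. -/
lemma hSlice_fourier (φ : 𝓢(R3, ℂ)) (t : ℝ) :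
    hSlice (𝓕 (φ : R3 → ℂ)) t = 𝓕 (fun y : R2 => 𝓕 (fun s : ℝ => φ (prodToR3 (y, s))) t) := by
  ext x
  rw [hSlice_eq, Real.fourier_eq, Real.fourier_eq,
    ← measurePreserving_prodToR3.integral_comp prodToR3.measurableEmbedding, integral_prod]
  · refine integral_congr_ae (Filter.Eventually.of_forall fun y => ?_)
    simp only
    rw [Real.fourier_eq, Circle.smul_def, ← integral_smul]
    refine integral_congr_ae (Filter.Eventually.of_forall fun s => ?_)
    simp only [inner_prodToR3, neg_add, AddChar.map_add_eq_mul, Circle.smul_def, Circle.coe_mul,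
      smul_smul]
    congr 4
    simp [mul_comm]
  · exact (measurePreserving_prodToR3.integrable_comp_emb prodToR3.measurableEmbedding).2
      ((Real.fourierIntegral_convergent_iff _).2 φ.integrable)

lemma integrable_comp_prodToR3 (φ : 𝓢(R3, ℂ)) :
    Integrable (fun p : R2 × ℝ => φ (prodToR3 p)) (volume.prod volume) :=
  (measurePreserving_prodToR3.integrable_comp_emb prodToR3.measurableEmbedding).2 φ.integrable

lemma continuous_vertFourier_integrand (φ : 𝓢(R3, ℂ)) :
    Continuous (fun q : (R2 × ℝ) × ℝ =>
      𝐞 (-(inner ℝ q.2 q.1.2)) • φ (prodToR3 (q.1.1, q.2))) := by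
  have h1 : Continuous fun q : (R2 × ℝ) × ℝ => φ (prodToR3 (q.1.1, q.2)) :=
    φ.continuous.comp (continuous_prodToR3.comp (by fun_prop))
  have h2 : Continuous fun q : (R2 × ℝ) × ℝ => 𝐞 (-(inner ℝ q.2 q.1.2)) :=
    Real.continuous_fourierChar.comp (by fun_prop)
  exact h2.smul h1

lemma stronglyMeasurable_vertFourier (φ : 𝓢(R3, ℂ)) :
    StronglyMeasurable (fun p : R2 × ℝ => 𝓕 (fun s : ℝ => φ (prodToR3 (p.1, s))) p.2) := by
  simp only [Real.fourier_eq]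
  exact (continuous_vertFourier_integrand φ).stronglyMeasurable.integral_prod_right

lemma integrable_vertFourier (φ : 𝓢(R3, ℂ)) (t : ℝ) :
    Integrable (fun y : R2 => 𝓕 (fun s : ℝ => φ (prodToR3 (y, s))) t) := by
  simp only [Real.fourier_eq]
  have h : Integrable (fun p : R2 × ℝ => 𝐞 (-(inner ℝ p.2 t)) • φ (prodToR3 p))
      (volume.prod volume) := by
    refine (integrable_comp_prodToR3 φ).mono ?_ (Filter.Eventually.of_forall fun p => ?_)
    · have := (continuous_vertFourier_integrand φ).comp
        (f := fun p : R2 × ℝ => ((p.1, t), p.2)) (by fun_prop)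
      exact this.aestronglyMeasurable
    · simp
  exact h.integral_prod_left

/-- The Fourier transform maps into `L²_v L⁴_h`, with a weighted energy bound. -/
lemma lintegral_eLpNorm_hSlice_fourier_le (φ : 𝓢(R3, ℂ)) :
    ∫⁻ t : ℝ, eLpNorm (hSlice (𝓕 (φ : R3 → ℂ)) t) 4 volume ^ (2 : ℝ) ≤
      planeSobolevConst ^ (2 : ℝ) * ∫⁻ ξ, ‖ξ‖ₑ * ‖φ ξ‖ₑ ^ (2 : ℝ) := by
  have hK : planeSobolevConst ^ (2 : ℝ) ≠ ⊤ :=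
    ENNReal.rpow_ne_top_of_nonneg (by norm_num) planeSobolevConst_ne_top
  set ψ : R2 × ℝ → ℂ := fun p => 𝓕 (fun s : ℝ => φ (prodToR3 (p.1, s))) p.2 with hψ
  have hψm : Measurable ψ := (stronglyMeasurable_vertFourier φ).measurable
  have hΦc : Continuous fun p : R2 × ℝ => φ (prodToR3 p) := φ.continuous.comp continuous_prodToR3
  have hΦ2 : MemLp (fun p : R2 × ℝ => φ (prodToR3 p)) 2 (volume.prod volume) :=
    (φ.memLp 2).comp_measurePreserving measurePreserving_prodToR3
  calc ∫⁻ t : ℝ, eLpNorm (hSlice (𝓕 (φ : R3 → ℂ)) t) 4 volume ^ (2 : ℝ)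
      ≤ ∫⁻ t : ℝ, planeSobolevConst ^ (2 : ℝ) * ∫⁻ y : R2, ‖y‖ₑ * ‖ψ (y, t)‖ₑ ^ (2 : ℝ) := by
        refine lintegral_mono fun t => ?_
        simp only
        rw [hSlice_fourier]
        refine (ENNReal.rpow_le_rpow (eLpNorm_four_fourier_le (integrable_vertFourier φ t))
          (by norm_num : (0 : ℝ) ≤ 2)).trans_eq ?_
        rw [ENNReal.mul_rpow_of_nonneg _ _ (by norm_num), ← ENNReal.rpow_mul]
        norm_num [hψ]
    _ = planeSobolevConst ^ (2 : ℝ) *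
          ∫⁻ y : R2, ∫⁻ t : ℝ, ‖y‖ₑ * ‖ψ (y, t)‖ₑ ^ (2 : ℝ) := by
        rw [lintegral_const_mul' _ _ hK, lintegral_lintegral_swap]
        exact (by fun_prop : Measurable fun p : ℝ × R2 =>
          ‖p.2‖ₑ * ‖ψ (p.2, p.1)‖ₑ ^ (2 : ℝ)).aemeasurable
    _ = planeSobolevConst ^ (2 : ℝ) *
          ∫⁻ y : R2, ∫⁻ s : ℝ, ‖y‖ₑ * ‖φ (prodToR3 (y, s))‖ₑ ^ (2 : ℝ) := by
        -- Plancherel in the vertical variable. Fubini gives integrability and square integrability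
        -- of `s ↦ φ (prodToR3 (y, s))` for almost every `y`, which is enough here.
        congr 1
        refine lintegral_congr_ae ?_
        have hfin : ∀ᵐ y : R2, ∫⁻ s : ℝ, ‖φ (prodToR3 (y, s))‖ₑ ^ (2 : ℝ) < ⊤ := by
          have h3 := hΦ2.2
          rw [eLpNorm_lt_top_iff_lintegral_rpow_enorm_lt_top (by norm_num) (by norm_num)] at h3
          simp only [ENNReal.toReal_ofNat] at h3
          have hm : Measurable fun p : R2 × ℝ => ‖φ (prodToR3 p)‖ₑ ^ (2 : ℝ) :=
            hΦc.measurable.enorm.pow_const _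
          rw [lintegral_prod _ hm.aemeasurable] at h3
          exact ae_lt_top hm.lintegral_prod_right' h3.ne
        filter_upwards [(integrable_comp_prodToR3 φ).prod_right_ae, hfin] with y hy1 hy2
        have hm : Measurable fun t => ‖ψ (y, t)‖ₑ ^ (2 : ℝ) := by fun_prop
        have hm' : Measurable fun s => ‖φ (prodToR3 (y, s))‖ₑ ^ (2 : ℝ) := by
          have := hΦc.comp (f := fun s : ℝ => (y, s)) (by fun_prop)
          exact (this.measurable.enorm).pow_const _
        rw [lintegral_const_mul _ hm, lintegral_const_mul _ hm']
        congr 1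
        refine lintegral_enorm_fourier_rpow_two hy1 ⟨hy1.1, ?_⟩
        rw [eLpNorm_lt_top_iff_lintegral_rpow_enorm_lt_top (by norm_num) (by norm_num)]
        simpa using hy2
    _ ≤ planeSobolevConst ^ (2 : ℝ) * ∫⁻ ξ, ‖ξ‖ₑ * ‖φ ξ‖ₑ ^ (2 : ℝ) := by
        have hφm : Measurable φ := φ.continuous.measurable
        rw [lintegral_R3 _ (by fun_prop), lintegral_lintegral_swap]
        · gcongr with t y
          rw [← ofReal_norm, ← ofReal_norm]
          exact ENNReal.ofReal_le_ofReal (norm_le_norm_prodToR3 _ _)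
        · exact (by fun_prop : Measurable fun p : R2 × ℝ =>
            ‖p.1‖ₑ * ‖φ (prodToR3 p)‖ₑ ^ (2 : ℝ)).aemeasurable

/-- The norm of `L²_v L^p_h`. -/
noncomputable def mixedNorm (p : ℝ≥0∞) (f : R3 → ℂ) : ℝ≥0∞ :=
  eLpNorm (fun t : ℝ => eLpNorm (hSlice f t) p volume) 2 volume

lemma mixedNorm_eq (p : ℝ≥0∞) (f : R3 → ℂ) :
    mixedNorm p f = (∫⁻ t : ℝ, eLpNorm (hSlice f t) p volume ^ (2 : ℝ)) ^ (1 / 2 : ℝ) := by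
  rw [mixedNorm, eLpNorm_eq_lintegral_rpow_enorm_toReal (by norm_num) (by norm_num)]
  simp

lemma continuous_hSlice {f : R3 → ℂ} (hf : Continuous f) (t : ℝ) : Continuous (hSlice f t) := by
  have : hSlice f t = fun y => f (prodToR3 (y, t)) := funext fun y => hSlice_eq f t y
  rw [this]
  exact hf.comp (continuous_prodToR3.comp (by fun_prop))

lemma measurable_eLpNorm_hSlice {f : R3 → ℂ} (hf : Continuous f) {p : ℝ≥0∞} (hp : p ≠ 0)
    (hp' : p ≠ ⊤) : Measurable fun t : ℝ => eLpNorm (hSlice f t) p volume := by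
  simp only [eLpNorm_eq_lintegral_rpow_enorm_toReal hp hp', hSlice_eq]
  have hm : Measurable fun q : ℝ × R2 => ‖f (prodToR3 (q.2, q.1))‖ₑ ^ p.toReal :=
    ((hf.comp (continuous_prodToR3.comp
      (by fun_prop : Continuous fun q : ℝ × R2 => (q.2, q.1)))).measurable.enorm).pow_const _
  exact hm.lintegral_prod_right'.pow_const _

lemma holderTriple_four_thirds_four_one : ENNReal.HolderTriple (4 / 3) 4 1 := by
  refine ⟨(ENNReal.toReal_eq_toReal_iff' ?_ ?_).1 ?_⟩
  · simp
  · simp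
  · rw [ENNReal.toReal_add (by simp) (by simp)]
    simp
    norm_num

lemma holderTriple_four_two_four_thirds : ENNReal.HolderTriple 4 2 (4 / 3) := by
  refine ⟨(ENNReal.toReal_eq_toReal_iff' ?_ ?_).1 ?_⟩
  · simp
  · simp
  · rw [ENNReal.toReal_add (by simp) (by simp)]
    simp
    norm_num

/-- Hölder's inequality for the mixed norms. -/
lemma lintegral_mul_le_mixedNorm {F G : R3 → ℂ} (hF : Continuous F) (hG : Continuous G) :
    ∫⁻ x, ‖F x‖ₑ * ‖G x‖ₑ ≤ mixedNorm (4 / 3) F * mixedNorm 4 G := by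
  have h43 : (4 / 3 : ℝ≥0∞) ≠ 0 := by simp
  have h43' : (4 / 3 : ℝ≥0∞) ≠ ⊤ := by simp [ENNReal.div_eq_top]
  rw [lintegral_R3 (fun x => ‖F x‖ₑ * ‖G x‖ₑ) (hF.measurable.enorm.mul hG.measurable.enorm)]
  have hs : ∀ t : ℝ, ∫⁻ y : R2, ‖F (prodToR3 (y, t))‖ₑ * ‖G (prodToR3 (y, t))‖ₑ ≤
      eLpNorm (hSlice F t) (4 / 3) volume * eLpNorm (hSlice G t) 4 volume := by
    intro t
    have := holderTriple_four_thirds_four_one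
    refine le_trans (le_of_eq ?_) (eLpNorm_smul_le_mul_eLpNorm (r := 1)
      (continuous_hSlice hG t).aestronglyMeasurable (continuous_hSlice hF t).aestronglyMeasurable)
    rw [eLpNorm_one_eq_lintegral_enorm]
    refine lintegral_congr fun y => ?_
    rw [Pi.smul_apply', hSlice_eq, hSlice_eq, smul_eq_mul, enorm_mul]
  refine (lintegral_mono hs).trans ?_
  rw [mixedNorm_eq, mixedNorm_eq]
  exact ENNReal.lintegral_mul_le_Lp_mul_Lq volume Real.HolderConjugate.two_two
    (measurable_eLpNorm_hSlice hF h43 h43').aemeasurable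
    (measurable_eLpNorm_hSlice hG (by norm_num) (by norm_num)).aemeasurable

/-! ### Duality: `L²_v L^{4/3}_h` embeds into `Ḣ^{-1/2}(ℝ³)`. -/

/-- A linear functional controlled by a linear map into a Hilbert space is represented there. -/
lemma exists_inner_eq_of_norm_le {V H : Type*} [AddCommGroup V] [Module ℂ V]
    [NormedAddCommGroup H] [InnerProductSpace ℂ H] [CompleteSpace H] (T : V →ₗ[ℂ] H)
    (l : V →ₗ[ℂ] ℂ) {C : ℝ} (hC : 0 ≤ C) (h : ∀ v, ‖l v‖ ≤ C * ‖T v‖) :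
    ∃ w : H, ‖w‖ ≤ C ∧ ∀ v, l v = inner ℂ w (T v) := by
  obtain ⟨s, hs⟩ := T.rangeRestrict.exists_rightInverse_of_surjective T.range_rangeRestrict
  have hsT : ∀ w : LinearMap.range T, T (s w) = w := fun w =>
    congrArg Subtype.val (LinearMap.congr_fun hs w)
  let g : LinearMap.range T →L[ℂ] ℂ := (l ∘ₗ s).mkContinuous C fun w => by
    refine (h (s w)).trans_eq ?_
    rw [hsT]; rfl
  have hg : ∀ v, g (T.rangeRestrict v) = l v := by
    intro v
    change l (s (T.rangeRestrict v)) = l v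
    -- The bound forces `l` to vanish on the kernel of `T`, so `l` factors through the range and the
    -- choice of the section `s` is immaterial.
    have h0 := h (s (T.rangeRestrict v) - v)
    rw [map_sub T, hsT] at h0
    rw [show ((T.rangeRestrict v : LinearMap.range T) : H) = T v from rfl, sub_self, norm_zero,
      mul_zero] at h0
    rw [← sub_eq_zero, ← map_sub]
    exact norm_le_zero_iff.1 h0
  obtain ⟨G, hG, hGn⟩ := exists_extension_norm_eq _ g
  refine ⟨(InnerProductSpace.toDual ℂ H).symm G, ?_, fun v => ?_⟩
  · rw [LinearIsometryEquiv.norm_map, hGn]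
    exact LinearMap.mkContinuous_norm_le _ hC _
  · rw [InnerProductSpace.toDual_symm_apply, ← hg]
    exact (hG _).symm

/-- The square root weight `‖ξ‖^{1/2}`. -/
noncomputable def sqrtWeight (ξ : R3) : ℂ := (√ ‖ξ‖ : ℝ)

lemma continuous_sqrtWeight : Continuous sqrtWeight := by
  unfold sqrtWeight
  fun_prop

lemma enorm_sqrtWeight_rpow_two (ξ : R3) : ‖sqrtWeight ξ‖ₑ ^ (2 : ℝ) = ‖ξ‖ₑ := by
  rw [← ofReal_norm, ENNReal.ofReal_rpow_of_nonneg (norm_nonneg _) (by norm_num), sqrtWeight,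
    Complex.norm_real, Real.rpow_two, Real.norm_of_nonneg (Real.sqrt_nonneg _),
    Real.sq_sqrt (norm_nonneg _), ofReal_norm]

lemma hasTemperateGrowth_one_add_norm_sq :
    Function.HasTemperateGrowth (fun ξ : R3 => ((1 + ‖ξ‖ ^ 2 : ℝ) : ℂ)) := by
  fun_prop

/-- The weight `‖ξ‖^{1/2}` is not smooth at the origin and does not act on Schwartz functions.
Domination by a smooth weight of temperate growth gives both square integrability and continuity in
the Schwartz topology. -/
lemma norm_sqrtWeight_le (ξ : R3) : ‖sqrtWeight ξ‖ ≤ ‖((1 + ‖ξ‖ ^ 2 : ℝ) : ℂ)‖ := by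
  rw [sqrtWeight, Complex.norm_real, Complex.norm_real, Real.norm_of_nonneg (Real.sqrt_nonneg _),
    Real.norm_of_nonneg (by positivity)]
  refine Real.sqrt_le_iff.2 ⟨by positivity, ?_⟩
  nlinarith [norm_nonneg ξ, sq_nonneg (‖ξ‖ ^ 2), sq_nonneg (‖ξ‖ - 1)]

lemma norm_weighted_le (φ : 𝓢(R3, ℂ)) (ξ : R3) : ‖sqrtWeight ξ * φ ξ‖ ≤
    ‖(SchwartzMap.smulLeftCLM ℂ (fun ξ : R3 => ((1 + ‖ξ‖ ^ 2 : ℝ) : ℂ)) φ) ξ‖ := by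
  rw [SchwartzMap.smulLeftCLM_apply_apply hasTemperateGrowth_one_add_norm_sq, smul_eq_mul,
    norm_mul, norm_mul]
  gcongr
  exact norm_sqrtWeight_le ξ

lemma memLp_weighted (φ : 𝓢(R3, ℂ)) : MemLp (fun ξ => sqrtWeight ξ * φ ξ) 2 :=
  (SchwartzMap.memLp (SchwartzMap.smulLeftCLM ℂ
    (fun ξ : R3 => ((1 + ‖ξ‖ ^ 2 : ℝ) : ℂ)) φ) 2).of_le
    (continuous_sqrtWeight.mul φ.continuous).aestronglyMeasurable
    (Filter.Eventually.of_forall (norm_weighted_le φ))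

/-- Multiplication of Schwartz functions by `‖ξ‖^{1/2}`, as a map into `L²`. -/
noncomputable def weightedL2 : 𝓢(R3, ℂ) →ₗ[ℂ] Lp ℂ 2 (volume : Measure R3) where
  toFun φ := (memLp_weighted φ).toLp _
  map_add' φ ψ := by
    rw [← MemLp.toLp_add]
    refine MemLp.toLp_congr _ _ (Filter.Eventually.of_forall fun ξ => ?_)
    simp [mul_add]
  map_smul' c φ := by
    rw [RingHom.id_apply, ← MemLp.toLp_const_smul]
    refine MemLp.toLp_congr _ _ (Filter.Eventually.of_forall fun ξ => ?_)
    simp [mul_left_comm]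

lemma enorm_weightedL2 (φ : 𝓢(R3, ℂ)) :
    ‖weightedL2 φ‖ₑ = (∫⁻ ξ, ‖ξ‖ₑ * ‖φ ξ‖ₑ ^ (2 : ℝ)) ^ (1 / 2 : ℝ) := by
  change ‖(memLp_weighted φ).toLp _‖ₑ = _
  rw [Lp.enorm_def, eLpNorm_congr_ae (memLp_weighted φ).coeFn_toLp,
    eLpNorm_eq_lintegral_rpow_enorm_toReal (by norm_num) (by norm_num)]
  simp only [ENNReal.toReal_ofNat, enorm_mul]
  congr 1
  refine lintegral_congr fun ξ => ?_
  rw [ENNReal.mul_rpow_of_nonneg _ _ (by norm_num), enorm_sqrtWeight_rpow_two]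

lemma norm_weightedL2_le (φ : 𝓢(R3, ℂ)) : ‖weightedL2 φ‖ ≤
    ‖SchwartzMap.toLpCLM ℂ ℂ 2 (volume : Measure R3)
      (SchwartzMap.smulLeftCLM ℂ (fun ξ : R3 => ((1 + ‖ξ‖ ^ 2 : ℝ) : ℂ)) φ)‖ := by
  refine Lp.norm_le_norm_of_ae_le ?_
  filter_upwards [(memLp_weighted φ).coeFn_toLp, SchwartzMap.coeFn_toLp
    (SchwartzMap.smulLeftCLM ℂ (fun ξ : R3 => ((1 + ‖ξ‖ ^ 2 : ℝ) : ℂ)) φ) 2] with ξ h1 h2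
  rw [SchwartzMap.toLpCLM_apply, h2]
  change ‖((memLp_weighted φ).toLp _) ξ‖ ≤ _
  rw [h1]
  exact norm_weighted_le φ ξ

lemma mixedNorm_four_fourier_le (φ : 𝓢(R3, ℂ)) :
    mixedNorm 4 (𝓕 (φ : R3 → ℂ)) ≤ planeSobolevConst * ‖weightedL2 φ‖ₑ := by
  rw [mixedNorm_eq, enorm_weightedL2]
  refine (ENNReal.rpow_le_rpow (lintegral_eLpNorm_hSlice_fourier_le φ)
    (by norm_num : (0 : ℝ) ≤ 1 / 2)).trans_eq ?_
  rw [ENNReal.mul_rpow_of_nonneg _ _ (by norm_num), ← ENNReal.rpow_mul]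
  norm_num

lemma integrable_mul_fourier {F : R3 → ℂ} (hF : Continuous F)
    (hfin : mixedNorm (4 / 3) F ≠ ⊤) (φ : 𝓢(R3, ℂ)) :
    Integrable (fun x => F x * 𝓕 φ x) := by
  refine ⟨(hF.mul (𝓕 φ : 𝓢(R3, ℂ)).continuous).aestronglyMeasurable, ?_⟩
  rw [hasFiniteIntegral_iff_enorm]
  simp only [enorm_mul]
  refine (lintegral_mul_le_mixedNorm hF (𝓕 φ : 𝓢(R3, ℂ)).continuous).trans_lt
    (ENNReal.mul_lt_top hfin.lt_top ?_)
  exact (mixedNorm_four_fourier_le φ).trans_lt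
    (ENNReal.mul_lt_top planeSobolevConst_ne_top.lt_top enorm_lt_top)

lemma norm_integral_mul_fourier_le {F : R3 → ℂ} (hF : Continuous F)
    (hfin : mixedNorm (4 / 3) F ≠ ⊤) (φ : 𝓢(R3, ℂ)) :
    ‖∫ x, F x * 𝓕 φ x‖ ≤ (planeSobolevConst * mixedNorm (4 / 3) F).toReal * ‖weightedL2 φ‖ := by
  have hK : planeSobolevConst * mixedNorm (4 / 3) F ≠ ⊤ :=
    ENNReal.mul_ne_top planeSobolevConst_ne_top hfin
  have h : ‖∫ x, F x * 𝓕 φ x‖ₑ ≤ planeSobolevConst * mixedNorm (4 / 3) F * ‖weightedL2 φ‖ₑ := by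
    refine (enorm_integral_le_lintegral_enorm _).trans ?_
    simp only [enorm_mul]
    refine (lintegral_mul_le_mixedNorm hF (𝓕 φ : 𝓢(R3, ℂ)).continuous).trans ?_
    refine (mul_le_mul_right (mixedNorm_four_fourier_le φ) _).trans_eq ?_
    rw [mul_left_comm, mul_assoc]
  have := ENNReal.toReal_mono (ENNReal.mul_ne_top hK enorm_ne_top) h
  rwa [ENNReal.toReal_mul, toReal_enorm, toReal_enorm] at this

/-- `L²_v L^{4/3}_h` embeds into `Ḣ^{-1/2}(ℝ³)`. -/
theorem homSobolevNorm_neg_half_le {F : R3 → ℂ} (hF : Continuous F) :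
    homSobolevNorm (-(1 / 2)) F ≤ planeSobolevConst * mixedNorm (4 / 3) F := by
  by_cases hfin : mixedNorm (4 / 3) F = ⊤
  · rw [hfin, ENNReal.mul_top planeSobolevConst_ne_zero]
    exact le_top
  set C := planeSobolevConst * mixedNorm (4 / 3) F with hC
  have hCfin : C ≠ ⊤ := ENNReal.mul_ne_top planeSobolevConst_ne_top hfin
  -- This functional is the Fourier transform of `F`, defined by duality before `F` is known to be a
  -- tempered distribution.
  let l : 𝓢(R3, ℂ) →ₗ[ℂ] ℂ :=
    { toFun := fun φ => ∫ x, F x * 𝓕 φ x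
      map_add' := fun φ ψ => by
        rw [← integral_add (integrable_mul_fourier hF hfin φ) (integrable_mul_fourier hF hfin ψ)]
        refine integral_congr_ae (Filter.Eventually.of_forall fun x => ?_)
        simp [FourierTransform.fourier_add, mul_add]
      map_smul' := fun c φ => by
        rw [RingHom.id_apply, ← integral_smul]
        refine integral_congr_ae (Filter.Eventually.of_forall fun x => ?_)
        simp [FourierTransform.fourier_smul, mul_left_comm] }
  have hl : ∀ φ, ‖l φ‖ ≤ C.toReal * ‖weightedL2 φ‖ := norm_integral_mul_fourier_le hF hfin
  have hlc : Continuous l := by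
    refine continuous_of_continuousAt_zero l ?_
    rw [ContinuousAt, map_zero]
    have hcont : Continuous fun φ : 𝓢(R3, ℂ) => C.toReal *
        ‖SchwartzMap.toLpCLM ℂ ℂ 2 (volume : Measure R3)
          (SchwartzMap.smulLeftCLM ℂ (fun ξ : R3 => ((1 + ‖ξ‖ ^ 2 : ℝ) : ℂ)) φ)‖ := by
      fun_prop
    have h0 := hcont.tendsto 0
    simp only [map_zero, norm_zero, mul_zero] at h0
    refine squeeze_zero_norm (fun φ => (hl φ).trans ?_) h0
    exact mul_le_mul_of_nonneg_left (norm_weightedL2_le φ) ENNReal.toReal_nonneg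
  obtain ⟨w, hwn, hw⟩ := exists_inner_eq_of_norm_le weightedL2 l ENNReal.toReal_nonneg hl
  let v : 𝓢'(R3, ℂ) := ContinuousLinearMap.toPointwiseConvergenceCLM _ _ _ _ (⟨l, hlc⟩ : 𝓢(R3, ℂ) →L[ℂ] ℂ)
  have hv : ∀ φ, v φ = ∫ x, F x * 𝓕 φ x := fun φ => rfl
  -- The inner product is conjugate linear in `w`, hence the conjugate. The weight `‖ξ‖^{-1}` of the
  -- `Ḣ^{-1/2}` norm cancels `|sqrtWeight|²`, which leaves the `L²` norm of `w`.
  set g : R3 → ℂ := fun ξ => (starRingEnd ℂ) (w ξ) * sqrtWeight ξ with hg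
  have hwm : AEStronglyMeasurable (w : R3 → ℂ) volume := (Lp.memLp w).1
  refine iInf₂_le_of_le (𝓕⁻ v) ⟨hF.locallyIntegrable, fun φ _ => ?_⟩
    (iInf₂_le_of_le g ⟨?_, fun φ _ => ?_⟩ ?_)
  · rw [TemperedDistribution.fourierInv_apply, hv, FourierTransform.fourier_fourierInv_eq]
  · have hwl : LocallyIntegrable (fun ξ => (starRingEnd ℂ) (w ξ)) :=
      ((Lp.memLp w).star).locallyIntegrable one_le_two
    rw [locallyIntegrable_iff]
    intro k hk
    exact (hwl.integrableOn_isCompact hk).mul_continuousOn continuous_sqrtWeight.continuousOn hk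
  · rw [FourierTransform.fourier_fourierInv_eq, hv]
    change l φ = _
    rw [hw, L2.inner_def]
    refine integral_congr_ae ?_
    filter_upwards [(memLp_weighted φ).coeFn_toLp] with ξ hξ
    change inner ℂ (w ξ) (((memLp_weighted φ).toLp _) ξ) = _
    rw [hξ, RCLike.inner_apply]
    simp only [hg]
    ring
  · have h1 : ∫⁻ ξ, ‖ξ‖ₑ ^ (2 * (-(1 / 2) : ℝ)) * ‖g ξ‖ₑ ^ (2 : ℝ)
        = ∫⁻ ξ, ‖w ξ‖ₑ ^ (2 : ℝ) := by
      refine lintegral_congr_ae ?_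
      have h0 : ∀ᵐ ξ : R3, ξ ≠ 0 := by simp [ae_iff]
      filter_upwards [h0] with ξ hξ
      have hξ' : ‖ξ‖ₑ ≠ 0 := by simpa using hξ
      rw [hg, enorm_mul, ENNReal.mul_rpow_of_nonneg _ _ (by norm_num), enorm_sqrtWeight_rpow_two,
        show (2 * (-(1 / 2)) : ℝ) = -1 by norm_num, ENNReal.rpow_neg_one, mul_left_comm,
        ENNReal.inv_mul_cancel hξ' enorm_ne_top, mul_one]
      congr 1
      simp [← ofReal_norm]
    rw [h1]
    have h2 : (∫⁻ ξ, ‖w ξ‖ₑ ^ (2 : ℝ)) ^ (1 / 2 : ℝ) = ‖w‖ₑ := by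
      rw [Lp.enorm_def, eLpNorm_eq_lintegral_rpow_enorm_toReal (by norm_num) (by norm_num)]
      simp
    rw [h2, ← ofReal_norm, ← ENNReal.ofReal_toReal hCfin]
    exact ENNReal.ofReal_le_ofReal hwn

/-! ### The product estimate in `L²_v L^{4/3}_h`. -/

lemma mixedNorm_mono {p : ℝ≥0∞} {f : R3 → ℂ} {G : ℝ → ℝ≥0∞}
    (h : ∀ t, eLpNorm (hSlice f t) p volume ≤ G t) : mixedNorm p f ≤ eLpNorm G 2 volume :=
  eLpNorm_mono_enorm fun t => by simpa using h t

lemma mixedNorm_four_le (a : R3 → ℂ) :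
    mixedNorm 4 a ≤ planeSobolevConst * lpvHomSobolevNorm 2 (1 / 2) a := by
  rw [mixedNorm_eq, lpvHomSobolevNorm,
    eLpNorm_eq_lintegral_rpow_enorm_toReal (by norm_num) (by norm_num)]
  -- Finiteness lets the constant leave the integral without any measurability of the slice norms
  -- `homSobolevNorm (1 / 2) (hSlice a t)` in `t`.
  have hK : planeSobolevConst ^ (2 : ℝ) ≠ ⊤ :=
    ENNReal.rpow_ne_top_of_nonneg (by norm_num) planeSobolevConst_ne_top
  simp only [ENNReal.toReal_ofNat, enorm_eq_self]
  calc (∫⁻ t : ℝ, eLpNorm (hSlice a t) 4 volume ^ (2 : ℝ)) ^ (1 / 2 : ℝ)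
      ≤ (∫⁻ t : ℝ, planeSobolevConst ^ (2 : ℝ) *
          homSobolevNorm (1 / 2) (hSlice a t) ^ (2 : ℝ)) ^ (1 / 2 : ℝ) := by
        gcongr with t
        rw [← ENNReal.mul_rpow_of_nonneg _ _ (by norm_num)]
        exact ENNReal.rpow_le_rpow (eLpNorm_four_le_homSobolevNorm _) (by norm_num)
    _ = _ := by
        rw [lintegral_const_mul' _ _ hK, ENNReal.mul_rpow_of_nonneg _ _ (by norm_num),
          ← ENNReal.rpow_mul]
        norm_num

lemma mixedNorm_two_eq {f : R3 → ℂ} (hf : Continuous f) : mixedNorm 2 f = eLpNorm f 2 volume := by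
  rw [mixedNorm_eq, eLpNorm_eq_lintegral_rpow_enorm_toReal (by norm_num) (by norm_num)]
  simp only [ENNReal.toReal_ofNat]
  rw [lintegral_R3 (fun x => ‖f x‖ₑ ^ (2 : ℝ)) (hf.measurable.enorm.pow_const _)]
  congr 1
  refine lintegral_congr fun t => ?_
  rw [eLpNorm_eq_lintegral_rpow_enorm_toReal (by norm_num) (by norm_num), ← ENNReal.rpow_mul]
  simp [hSlice_eq]

lemma hasDerivAt_vertical {b : R3 → ℂ} (hb : ContDiff ℝ ∞ b) (y : R2) (s : ℝ) :
    HasDerivAt (fun s => hSlice b s y) (hSlice (vertDeriv b) s y) s := by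
  have h1 : HasDerivAt (fun s : ℝ => (!₂[y 0, y 1, s] : R3)) (EuclideanSpace.single 2 1) s := by
    have e : (fun s : ℝ => (!₂[y 0, y 1, s] : R3)) = fun s =>
        (!₂[y 0, y 1, 0] : R3) + s • (EuclideanSpace.single 2 1 : R3) := by
      ext s i
      fin_cases i <;> simp
    rw [e]
    simpa using ((hasDerivAt_id s).smul_const (EuclideanSpace.single 2 1 : R3)).const_add
      (!₂[y 0, y 1, 0] : R3)
  exact ((hb.differentiable (by simp)) _).hasFDerivAt.comp_hasDerivAt s h1

lemma continuous_vertDeriv {b : R3 → ℂ} (hb : ContDiff ℝ ∞ b) : Continuous (vertDeriv b) :=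
  (hb.continuous_fderiv (by simp)).clm_apply continuous_const

lemma continuous_vertical {f : R3 → ℂ} (hf : Continuous f) (y : R2) :
    Continuous fun s => hSlice f s y := by
  simp only [hSlice_eq]
  exact hf.comp (continuous_prodToR3.comp (by fun_prop))

/-- Pointwise bound for vertical increments. -/
lemma enorm_vertical_increment_le {b : R3 → ℂ} (hb : ContDiff ℝ ∞ b) (y : R2) (t : ℝ) :
    ‖hSlice b t y - hSlice b 0 y‖ₑ ^ (4 : ℝ) ≤
      ‖t‖ₑ ^ (3 : ℝ) * ∫⁻ s in Set.uIoc 0 t, ‖hSlice (vertDeriv b) s y‖ₑ ^ (4 : ℝ) := by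
  have hc := continuous_vertical (continuous_vertDeriv hb) y
  have h1 : ‖hSlice b t y - hSlice b 0 y‖ₑ ≤
      eLpNorm (fun s => hSlice (vertDeriv b) s y) 1 (volume.restrict (Set.uIoc 0 t)) := by
    rw [← intervalIntegral.integral_eq_sub_of_hasDerivAt
      (fun s _ => hasDerivAt_vertical hb y s) (hc.intervalIntegrable 0 t), eLpNorm_one_eq_lintegral_enorm,
      ← ofReal_norm, intervalIntegral.norm_integral_eq_norm_integral_uIoc, ofReal_norm]
    exact enorm_integral_le_lintegral_enorm _
  -- Hölder on an interval of length `|t|` costs `|t|^{3/4}`, that is `|t|³` after the fourth power.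
  -- With fourth powers, integration in `y` requires only Tonelli instead of Minkowski's integral
  -- inequality; the remaining factor `|t|` comes from the length of the interval.
  have h2 := eLpNorm_le_eLpNorm_mul_rpow_measure_univ (p := 1) (q := 4)
    (μ := volume.restrict (Set.uIoc 0 t)) (by norm_num) hc.aestronglyMeasurable
  have hvol : (volume.restrict (Set.uIoc 0 t)) Set.univ = ‖t‖ₑ := by
    rw [Measure.restrict_apply_univ, Set.uIoc, Real.volume_Ioc, max_sub_min_eq_abs, sub_zero,
      ← ofReal_norm, Real.norm_eq_abs]
  rw [hvol, eLpNorm_eq_lintegral_rpow_enorm_toReal (p := 4) (by norm_num) (by norm_num)] at h2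
  refine (ENNReal.rpow_le_rpow (h1.trans h2) (by norm_num)).trans_eq ?_
  rw [ENNReal.mul_rpow_of_nonneg _ _ (by norm_num), ← ENNReal.rpow_mul, ← ENNReal.rpow_mul,
    mul_comm]
  norm_num

/-- Vertical increments in `L⁴_h`. -/
lemma eLpNorm_vertical_increment_le {b : R3 → ℂ} (hb : ContDiff ℝ ∞ b) (t : ℝ) :
    eLpNorm (hSlice b t - hSlice b 0) 4 volume ≤
      ‖t‖ₑ * (planeSobolevConst * lpvHomSobolevNorm ⊤ (1 / 2) (vertDeriv b)) := by
  set D := planeSobolevConst * lpvHomSobolevNorm ⊤ (1 / 2) (vertDeriv b) with hD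
  have hc := continuous_vertDeriv hb
  have hslice : ∀ᵐ s : ℝ, ∫⁻ y, ‖hSlice (vertDeriv b) s y‖ₑ ^ (4 : ℝ) ≤ D ^ (4 : ℝ) := by
    have := enorm_ae_le_eLpNormEssSup
      (fun s : ℝ => homSobolevNorm (1 / 2) (hSlice (vertDeriv b) s)) volume
    filter_upwards [this] with s hs
    have h1 : eLpNorm (hSlice (vertDeriv b) s) 4 volume ≤ D := by
      refine (eLpNorm_four_le_homSobolevNorm _).trans ?_
      rw [hD, lpvHomSobolevNorm, eLpNorm_exponent_top]
      exact mul_le_mul_right hs _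
    refine le_trans (le_of_eq ?_) (ENNReal.rpow_le_rpow h1 (by norm_num : (0 : ℝ) ≤ 4))
    rw [eLpNorm_eq_lintegral_rpow_enorm_toReal (by norm_num) (by norm_num), ← ENNReal.rpow_mul]
    norm_num
  have hm : Measurable fun q : R2 × ℝ => ‖hSlice (vertDeriv b) q.2 q.1‖ₑ ^ (4 : ℝ) := by
    simp only [hSlice_eq]
    exact ((hc.comp continuous_prodToR3).measurable.enorm).pow_const _
  have hvol : volume (Set.uIoc 0 t) = ‖t‖ₑ := by
    rw [Set.uIoc, Real.volume_Ioc, max_sub_min_eq_abs, sub_zero, ← ofReal_norm, Real.norm_eq_abs]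
  have key : ∫⁻ y, ‖hSlice b t y - hSlice b 0 y‖ₑ ^ (4 : ℝ) ≤ (‖t‖ₑ * D) ^ (4 : ℝ) := by
    have ht : ‖t‖ₑ ^ (3 : ℝ) ≠ ⊤ := ENNReal.rpow_ne_top_of_nonneg (by norm_num) enorm_ne_top
    calc ∫⁻ y, ‖hSlice b t y - hSlice b 0 y‖ₑ ^ (4 : ℝ)
        ≤ ∫⁻ y, ‖t‖ₑ ^ (3 : ℝ) *
            ∫⁻ s in Set.uIoc 0 t, ‖hSlice (vertDeriv b) s y‖ₑ ^ (4 : ℝ) :=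
          lintegral_mono fun y => enorm_vertical_increment_le hb y t
      _ = ‖t‖ₑ ^ (3 : ℝ) *
            ∫⁻ s in Set.uIoc 0 t, ∫⁻ y, ‖hSlice (vertDeriv b) s y‖ₑ ^ (4 : ℝ) := by
          rw [lintegral_const_mul' _ _ ht, lintegral_lintegral_swap hm.aemeasurable]
      _ ≤ ‖t‖ₑ ^ (3 : ℝ) * ∫⁻ _ in Set.uIoc 0 t, D ^ (4 : ℝ) :=
          mul_le_mul_right (lintegral_mono_ae (ae_restrict_of_ae hslice)) _
      _ = (‖t‖ₑ * D) ^ (4 : ℝ) := by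
          rw [setLIntegral_const, hvol, ENNReal.mul_rpow_of_nonneg ‖t‖ₑ D (by norm_num)]
          norm_cast
          ring
  rw [eLpNorm_eq_lintegral_rpow_enorm_toReal (by norm_num) (by norm_num)]
  refine (ENNReal.rpow_le_rpow key (by norm_num)).trans_eq ?_
  rw [← ENNReal.rpow_mul]
  norm_num

/-- Slice-wise Hölder estimate for the product. -/
lemma eLpNorm_hSlice_mul_le {a b : R3 → ℂ} (ha : Continuous a) (hb : ContDiff ℝ ∞ b) (t : ℝ) :
    eLpNorm (hSlice (fun x => a x * b x) t) (4 / 3) volume ≤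
      eLpNorm (hSlice a t) 4 volume * eLpNorm (hSlice b 0) 2 volume +
      eLpNorm (hSlice (fun x => (x 2 : ℂ) * a x) t) 2 volume *
        (planeSobolevConst * lpvHomSobolevNorm ⊤ (1 / 2) (vertDeriv b)) := by
  have := holderTriple_four_two_four_thirds
  have : ENNReal.HolderTriple 2 4 (4 / 3) := ENNReal.HolderTriple.symm
  have hat := (continuous_hSlice ha t).aestronglyMeasurable (μ := volume)
  have hb0 := (continuous_hSlice hb.continuous 0).aestronglyMeasurable (μ := volume)
  have hbt := (continuous_hSlice hb.continuous t).aestronglyMeasurable (μ := volume)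
  have h43 : (1 : ℝ≥0∞) ≤ 4 / 3 := by
    rw [ENNReal.le_div_iff_mul_le (by simp) (by simp)]
    norm_num
  have e : hSlice (fun x => a x * b x) t =
      hSlice a t • hSlice b 0 + hSlice a t • (hSlice b t - hSlice b 0) := by
    rw [← smul_add, add_sub_cancel]
    rfl
  rw [e]
  refine (eLpNorm_add_le (hat.smul hb0) (hat.smul (hbt.sub hb0)) h43).trans
    (add_le_add (eLpNorm_smul_le_mul_eLpNorm hb0 hat) ?_)
  refine (eLpNorm_smul_le_mul_eLpNorm (p := 2) (q := 4) (hbt.sub hb0) hat).trans ?_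
  refine (mul_le_mul_right (eLpNorm_vertical_increment_le hb t) _).trans_eq ?_
  -- The factor `|t|` of the increment bound is moved onto `a`.
  have e2 : hSlice (fun x => (x 2 : ℂ) * a x) t = (t : ℂ) • hSlice a t := rfl
  rw [e2, eLpNorm_const_smul, ← mul_assoc, mul_comm _ ‖t‖ₑ]
  congr 2
  simp [← ofReal_norm]

theorem mainTheorem8 :
    ∃ C : NNReal, ∀ a b : R3 → ℂ, ContDiff ℝ ∞ a → ContDiff ℝ ∞ b →
      homSobolevNorm (-(1 / 2)) (fun x => a x * b x) ≤
        C * (lpvHomSobolevNorm 2 (1 / 2) a * eLpNorm (hSlice b 0) 2 volume) +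
        C * (eLpNorm (fun x : R3 => (x 2 : ℂ) * a x) 2 volume *
          lpvHomSobolevNorm ∞ (1 / 2) (vertDeriv b)) := by
  -- One factor comes from the dual embedding, the other from the `L⁴_h` bound of `a` in the first
  -- term and of `∂₃b` in the second.
  refine ⟨(planeSobolevConst * planeSobolevConst).toNNReal, fun a b ha hb => ?_⟩
  rw [ENNReal.coe_toNNReal (ENNReal.mul_ne_top planeSobolevConst_ne_top planeSobolevConst_ne_top)]
  have hxa : Continuous fun x : R3 => (x 2 : ℂ) * a x :=
    (Complex.continuous_ofReal.comp (by fun_prop)).mul ha.continuous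
  have hma : Measurable fun t : ℝ => eLpNorm (hSlice a t) 4 volume :=
    measurable_eLpNorm_hSlice ha.continuous (by norm_num) (by norm_num)
  have hmx : Measurable fun t : ℝ => eLpNorm (hSlice (fun x => (x 2 : ℂ) * a x) t) 2 volume :=
    measurable_eLpNorm_hSlice hxa (by norm_num) (by norm_num)
  -- The constant `c` may be infinite here, so measurability of `G` is used instead of finiteness of
  -- `c`.
  have hmul : ∀ (G : ℝ → ℝ≥0∞) (c : ℝ≥0∞), Measurable G →
      eLpNorm (fun t => G t * c) 2 volume = eLpNorm G 2 volume * c := by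
    intro G c hG
    rw [eLpNorm_eq_lintegral_rpow_enorm_toReal (by norm_num) (by norm_num),
      eLpNorm_eq_lintegral_rpow_enorm_toReal (by norm_num) (by norm_num)]
    simp only [enorm_eq_self, ENNReal.toReal_ofNat]
    simp only [ENNReal.mul_rpow_of_nonneg _ _ (zero_le_two (α := ℝ))]
    rw [lintegral_mul_const _ (hG.pow_const _), ENNReal.mul_rpow_of_nonneg _ _ (by norm_num),
      ← ENNReal.rpow_mul]
    norm_num
  have hprod : mixedNorm (4 / 3) (fun x => a x * b x) ≤
      mixedNorm 4 a * eLpNorm (hSlice b 0) 2 volume +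
      eLpNorm (fun x : R3 => (x 2 : ℂ) * a x) 2 volume *
        (planeSobolevConst * lpvHomSobolevNorm ⊤ (1 / 2) (vertDeriv b)) := by
    refine (mixedNorm_mono fun t => eLpNorm_hSlice_mul_le ha.continuous hb t).trans ?_
    refine (eLpNorm_add_le (hma.mul_const _).aestronglyMeasurable
      (hmx.mul_const _).aestronglyMeasurable one_le_two).trans_eq ?_
    rw [hmul _ _ hma, hmul _ _ hmx, ← mixedNorm_two_eq hxa]
    rfl
  refine (homSobolevNorm_neg_half_le (ha.continuous.mul hb.continuous)).trans ?_
  refine (mul_le_mul_right hprod _).trans ?_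
  rw [mul_add]
  refine add_le_add ?_ (le_of_eq (by ring))
  refine (mul_le_mul_right (mul_le_mul_left (mixedNorm_four_le a) _) _).trans_eq ?_
  ring
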